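/- Let $n\ge 3$ and let $P$ be a hyperbolic $n$-gon, i.e. a polygon in the hyperbolic plane bounded by a simple closed curve made of $n$ geodesic segments (all vertices lie in the hyperbolic plane). Suppose that $P$ is tangential: all its sides are tangent to one circle, the incircle, of radius $r=r(P)>0$ (the points of tangency lying on the sides). Then $\sin(\pi/n)\cosh r(P)<1$ and $$\operatorname{Area}(P)\;\ge\;(n-2)\pi-2n\cos^{-1}\bigl(\sin(\pi/n)\,\cosh r(P)\bigr),$$ with equality if and only if $P$ is regular, i.e. all its sides are equal and all its interior angles are equal. -/

import Mathlib

open scoped UpperHalfPlane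
open MeasureTheory

noncomputable section

namespace HyperbolicPlane

/-- The geodesic segment from `a` to `b` in the hyperbolic plane. -/
def segment (a b : ℍ) : Set ℍ := {x | dist a x + dist x b = dist a b}

/-- The complete geodesic through two distinct points `a` and `b`: the points `x` for which
one of `a`, `b`, `x` lies between the other two. -/
def line (a b : ℍ) : Set ℍ := {x | x ∈ segment a b ∨ b ∈ segment a x ∨ a ∈ segment x b}

/-- The Cayley map `w ↦ (w - z) / (w - conj z)`. It maps the upper half-plane conformally (and
preserving orientation) onto the unit disc, sends `z` to `0` and the geodesic rays from `z` to
Euclidean rays from `0`. So it reads off directions at `z`. -/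
def direction (z w : ℍ) : ℂ := ((w : ℂ) - z) / ((w : ℂ) - (starRingEnd ℂ) (z : ℂ))

/-- The oriented (counterclockwise) angle, modulo `2π`, at `z` from the geodesic ray towards `u`
to the geodesic ray towards `w`. -/
def orientedAngle (u z w : ℍ) : Real.Angle := ((direction z w / direction z u).arg : Real.Angle)

/-- A hyperbolic `n`-gon: `n ≥ 3` vertices in cyclic order such that the closed geodesic
polygonal curve through them is simple. -/
structure Polygon (n : ℕ) where
  three_le : 3 ≤ n
  vertex : ZMod n → ℍ
  vertex_injective : Function.Injective vertex
  adjacent_sides : ∀ i : ZMod n,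
    segment (vertex i) (vertex (i + 1)) ∩ segment (vertex (i + 1)) (vertex (i + 1 + 1))
      = {vertex (i + 1)}
  nonadjacent_sides : ∀ i j : ZMod n, i ≠ j → j ≠ i + 1 → i ≠ j + 1 →
    Disjoint (segment (vertex i) (vertex (i + 1))) (segment (vertex j) (vertex (j + 1)))

namespace Polygon

variable {n : ℕ} (P : Polygon n)

/-- The side from vertex `i` to vertex `i + 1`. -/
def side (i : ZMod n) : Set ℍ := segment (P.vertex i) (P.vertex (i + 1))

/-- The boundary curve, the union of the sides. -/
def boundary : Set ℍ := ⋃ i, P.side i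

/-- The closed polygonal region: the boundary curve together with the points that it encloses,
i.e. those in bounded connected components of its complement. -/
def region : Set ℍ :=
  P.boundary ∪ {x | x ∉ P.boundary ∧ Bornology.IsBounded (connectedComponentIn P.boundaryᶜ x)}

/-- The hyperbolic area of the polygon (`volume` on `ℍ` is the measure `dx dy / y ^ 2`). -/
def area : ℝ := (volume : Measure ℍ).real P.region

/-- The length of the side from vertex `i` to vertex `i + 1`. -/
def sideLength (i : ZMod n) : ℝ := dist (P.vertex i) (P.vertex (i + 1))

/-- The angle at vertex `i`, from the next vertex to the previous one, modulo `2π`. If the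
vertices are listed counterclockwise, these are the interior angles of the polygon; if they are
listed clockwise, they are `2π` minus the interior angles. In both cases two of them coincide
exactly when the corresponding interior angles (which lie in `(0, 2π)`) coincide. -/
def vertexAngle (i : ZMod n) : Real.Angle :=
  orientedAngle (P.vertex (i + 1)) (P.vertex i) (P.vertex (i - 1))

/-- A polygon is regular if all sides are equal and all interior angles are equal. -/
def IsRegular : Prop :=
  (∀ i j : ZMod n, P.sideLength i = P.sideLength j) ∧
    ∀ i j : ZMod n, P.vertexAngle i = P.vertexAngle j

/-- The circle with centre `c` and radius `r > 0` is an incircle of the polygon: each side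
is tangent to it, i.e. the geodesic that carries the side meets the circle in exactly
one point, and that point of tangency lies on the side. -/
def IsIncircle (c : ℍ) (r : ℝ) : Prop :=
  0 < r ∧ ∀ i : ZMod n, ∃ t ∈ P.side i,
    line (P.vertex i) (P.vertex (i + 1)) ∩ Metric.sphere c r = {t}

end Polygon

end HyperbolicPlane

end

/-! The proof works in the Klein model with the centre of the incircle at the origin. Geodesics
become straight lines (`mem_segment_iff`) and the incircle becomes the Euclidean circle of radius `R
= tanh r`, so the polygon becomes a Euclidean polygon whose sides touch that circle. It is
determined by the points of tangency, or by the angles `2 * α i` between consecutive ones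
(`IsIncircle.exists_cycle`); a reflection, encoded in the sign `σ`, makes all of them turn
counterclockwise.

The `α i` add up to a multiple of `π`. If the polygon went around the circle twice or more, two
nonadjacent sides would meet, so simplicity forces `∑ α i = π` (`sum_halfAngle_eq_pi`). The polar
angles then split into one sector per side, the enclosed region is the intersection of the
half-planes of the tangents (`region_eq`), and integrating the Klein area density over the sectors
gives `Area = 2 * ∑ arcsin (cosh r * sin (α i)) - 2 * π` (`area_eq`). This is Gauss–Bonnet, since
the interior angle `β` at a vertex satisfies `cos (β / 2) = cosh r * sin α`.

For `K = cosh r > 1` the function `x ↦ arcsin (K * sin x)` is strictly convex where `K * sin x < 1`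
(`strictConvexOn_arcsin_mul_sin`), a condition that holds at every `α i` because the vertices lie
inside the unit disc. Jensen's inequality at the mean `π / n` gives the bound, with equality exactly
when all `α i` coincide, which means that the polygon is regular (`isRegular_iff`). -/

noncomputable section

namespace HyperbolicPlane

/-! ### The Klein model centred at a point, and geodesic segments in it -/

section

theorem inner_eq_re_add_im (z w : ℂ) : inner ℝ z w = z.re * w.re + z.im * w.im := by
  simp [Complex.inner, mul_comm]

theorem norm_sq_eq_re_add_im (z : ℂ) : ‖z‖ ^ 2 = z.re ^ 2 + z.im ^ 2 := by
  rw [← Complex.normSq_eq_norm_sq, Complex.normSq_apply]; ring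

/-- The denominator of the Klein map centred at `c`. -/
def kleinDenom (c z : ℍ) : ℝ := c.im ^ 2 + (z.re - c.re) ^ 2 + z.im ^ 2

theorem kleinDenom_pos (c z : ℍ) : 0 < kleinDenom c z := by
  have := z.im_pos
  unfold kleinDenom; positivity

/-- The map to the Klein model (in the unit disc) that sends `c` to `0`. The sign `σ = ±1` is
its orientation. -/
def klein (c : ℍ) (σ : ℝ) (z : ℍ) : ℂ :=
  ⟨2 * c.im * (z.re - c.re) / kleinDenom c z,
    σ * ((z.re - c.re) ^ 2 + z.im ^ 2 - c.im ^ 2) / kleinDenom c z⟩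

/-- The time coordinate in the hyperboloid model with origin `c`. -/
def lorentz (c z : ℍ) : ℝ := kleinDenom c z / (2 * c.im * z.im)

theorem lorentz_pos (c z : ℍ) : 0 < lorentz c z := by
  have := z.im_pos
  have := c.im_pos
  have := kleinDenom_pos c z
  unfold lorentz; positivity

variable {c : ℍ} {σ : ℝ}

/-- The equation of the hyperboloid: the vector with time part `lorentz` and space part `lorentz •
klein` has Minkowski square `1`. -/
theorem lorentz_sq_mul (hσ : σ ^ 2 = 1) (z : ℍ) :
    lorentz c z ^ 2 * (1 - ‖klein c σ z‖ ^ 2) = 1 := by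
  have h1 := z.im_pos
  have h2 := c.im_pos
  have h3 := kleinDenom_pos c z
  rw [norm_sq_eq_re_add_im]
  simp only [klein, lorentz]
  have : σ * ((z.re - c.re) ^ 2 + z.im ^ 2 - c.im ^ 2) / kleinDenom c z =
    σ * (((z.re - c.re) ^ 2 + z.im ^ 2 - c.im ^ 2) / kleinDenom c z) := by ring
  rw [this, mul_pow, hσ]
  field_simp
  unfold kleinDenom
  ring

theorem norm_klein_sq_lt_one (hσ : σ ^ 2 = 1) (z : ℍ) : ‖klein c σ z‖ ^ 2 < 1 := by
  have h := lorentz_sq_mul (c := c) hσ z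
  have h2 : 0 < lorentz c z ^ 2 := pow_pos (lorentz_pos c z) 2
  by_contra! h3
  nlinarith

theorem norm_klein_lt_one (hσ : σ ^ 2 = 1) (z : ℍ) : ‖klein c σ z‖ < 1 := by
  have := norm_klein_sq_lt_one (c := c) hσ z
  nlinarith [norm_nonneg (klein c σ z)]

/-- The Minkowski product of the two hyperboloid vectors. All later metric facts reduce to this
formula and `lorentz_sq_mul`. -/
theorem cosh_dist_eq (hσ : σ ^ 2 = 1) (z w : ℍ) : Real.cosh (dist z w) =
    lorentz c z * lorentz c w * (1 - inner ℝ (klein c σ z) (klein c σ w)) := by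
  have h1 := z.im_pos
  have h2 := c.im_pos
  have h3 := kleinDenom_pos c z
  have h4 := w.im_pos
  have h5 := kleinDenom_pos c w
  have h6 : dist (z : ℂ) w ^ 2 = (z.re - w.re) ^ 2 + (z.im - w.im) ^ 2 := by
    rw [dist_eq_norm, norm_sq_eq_re_add_im]; simp
  rw [UpperHalfPlane.cosh_dist, h6, inner_eq_re_add_im]
  simp only [klein, lorentz]
  have : σ * ((z.re - c.re) ^ 2 + z.im ^ 2 - c.im ^ 2) / kleinDenom c z *
      (σ * ((w.re - c.re) ^ 2 + w.im ^ 2 - c.im ^ 2) / kleinDenom c w) =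
      σ ^ 2 * (((z.re - c.re) ^ 2 + z.im ^ 2 - c.im ^ 2) / kleinDenom c z *
      (((w.re - c.re) ^ 2 + w.im ^ 2 - c.im ^ 2) / kleinDenom c w)) := by ring
  rw [this, hσ]
  field_simp
  unfold kleinDenom
  ring

theorem klein_self : klein c σ c = 0 := by
  apply Complex.ext <;> simp [klein]

theorem lorentz_self : lorentz c c = 1 := by
  have := c.im_pos
  unfold lorentz kleinDenom
  field_simp
  ring

theorem cosh_dist_center (z : ℍ) : Real.cosh (dist z c) = lorentz c z := by
  rw [cosh_dist_eq (c := c) (σ := 1) (by norm_num), klein_self, lorentz_self]; simp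

theorem klein_injective (hσ : σ ^ 2 = 1) : Function.Injective (klein c σ) := by
  intro z w h
  have h1 := lorentz_sq_mul (c := c) hσ z
  have h2 := lorentz_sq_mul (c := c) hσ w
  have h3 := cosh_dist_eq (c := c) hσ z w
  rw [← h] at h2 h3
  have hp := lorentz_pos c z
  have hq := lorentz_pos c w
  have h4 : lorentz c z = lorentz c w := by
    have h5 : 0 < 1 - ‖klein c σ z‖ ^ 2 := by linarith [norm_klein_sq_lt_one (c := c) hσ z]
    have : lorentz c z ^ 2 = lorentz c w ^ 2 :=
      mul_right_cancel₀ h5.ne' (h1.trans h2.symm)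
    exact (pow_left_inj₀ hp.le hq.le two_ne_zero).1 this
  rw [← h4, real_inner_self_eq_norm_sq] at h3
  have h5 : Real.cosh (dist z w) = 1 := by
    rw [h3]; linear_combination h1
  by_contra hne
  have := (Real.one_lt_cosh (x := dist z w)).2 (dist_pos.2 hne).ne'
  linarith

theorem exists_klein_eq (hσ : σ ^ 2 = 1) {k : ℂ} (hk : ‖k‖ < 1) : ∃ z, klein c σ z = k := by
  have hb := c.im_pos
  have hk2 : k.re ^ 2 + k.im ^ 2 < 1 := by
    rw [← norm_sq_eq_re_add_im]; nlinarith [norm_nonneg k]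
  have hσk : (σ * k.im) ^ 2 = k.im ^ 2 := by rw [mul_pow, hσ, one_mul]
  set s := σ * k.im with hs
  have hs1 : 0 < 1 - s := by nlinarith [sq_nonneg k.re]
  set m := √(1 - k.re ^ 2 - s ^ 2) with hm
  have hm0 : 0 < m := Real.sqrt_pos.2 (by linarith)
  have hm2 : m ^ 2 = 1 - k.re ^ 2 - s ^ 2 := Real.sq_sqrt (by linarith)
  -- The witness comes from solving for `z`: the imaginary part of the Klein map determines
  -- `kleinDenom = 2 * c.im ^ 2 / (1 - s)`, and `m` is the reciprocal of the Lorentz factor.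
  refine ⟨⟨⟨c.re + c.im * k.re / (1 - s), c.im * m / (1 - s)⟩, by simp; positivity⟩, ?_⟩
  have hN : kleinDenom c ⟨⟨c.re + c.im * k.re / (1 - s), c.im * m / (1 - s)⟩,
      by simp; positivity⟩ = 2 * c.im ^ 2 / (1 - s) := by
    simp only [kleinDenom, UpperHalfPlane.re, UpperHalfPlane.im]
    have e : (c.coe.im * m / (1 - s)) ^ 2 =
        c.coe.im ^ 2 * (1 - k.re ^ 2 - s ^ 2) / (1 - s) ^ 2 := by
      rw [div_pow, mul_pow, hm2]
    rw [e]; field_simp; ring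
  have hsk : σ * s = k.im := by rw [hs, ← mul_assoc, ← sq, hσ, one_mul]
  apply Complex.ext
  · simp only [klein, hN]
    simp only [UpperHalfPlane.re, UpperHalfPlane.im] at *
    field_simp; ring
  · simp only [klein, hN]
    simp only [UpperHalfPlane.re, UpperHalfPlane.im] at *
    have e : (c.coe.im * m / (1 - s)) ^ 2 =
        c.coe.im ^ 2 * (1 - k.re ^ 2 - s ^ 2) / (1 - s) ^ 2 := by
      rw [div_pow, mul_pow, hm2]
    rw [e, ← hsk]; field_simp; ring

theorem continuous_klein : Continuous (klein c σ) := by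
  have h1 : Continuous fun z : ℍ => (klein c σ z).re := by
    simp only [klein, kleinDenom]
    refine Continuous.div (by fun_prop) (by fun_prop) fun z => (kleinDenom_pos c z).ne'
  have h2 : Continuous fun z : ℍ => (klein c σ z).im := by
    simp only [klein, kleinDenom]
    refine Continuous.div (by fun_prop) (by fun_prop) fun z => (kleinDenom_pos c z).ne'
  have : klein c σ = fun z => ((klein c σ z).re : ℂ) + ((klein c σ z).im : ℂ) * Complex.I := by
    ext z; simp
  rw [this]
  fun_prop

/-- A vector of the Minkowski space that is null and orthogonal to a timelike vector vanishes. -/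
theorem eq_zero_of_null {w x : ℝ} {v k : ℂ} (hk : ‖k‖ < 1) (hx : x ≠ 0)
    (h1 : w ^ 2 = ‖v‖ ^ 2) (h2 : w * x = inner ℝ v (x • k)) : w = 0 ∧ v = 0 := by
  rw [inner_smul_right, mul_comm] at h2
  have h3 : w = inner ℝ v k := mul_left_cancel₀ hx h2
  have h4 := abs_real_inner_le_norm v k
  rw [← h3, ← abs_norm v, ← (sq_eq_sq_iff_abs_eq_abs _ _).1 h1] at h4
  have h5 : w = 0 := by
    by_contra hw
    have := abs_pos.2 hw
    nlinarith
  refine ⟨h5, ?_⟩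
  rw [h5] at h1
  have := pow_eq_zero_iff (two_ne_zero) |>.1 (h1.symm.trans (by norm_num) : ‖v‖ ^ 2 = 0)
  simpa using this

/-- Minkowski products of `x = l a + m b` with `a`, `b` and `x` give the hyperbolic cosines of both
distances and a relation between `l` and `m`. Both hyperbolic sines are then multiples of `sinh
(dist a b)`, and the addition formula closes the argument. -/
theorem dist_add_dist_eq_of_comb (hσ : σ ^ 2 = 1) {a b x : ℍ} {l m : ℝ} (hl : 0 ≤ l) (hm : 0 ≤ m)
    (h0 : lorentz c x = l * lorentz c a + m * lorentz c b)
    (h1 : lorentz c x • klein c σ x = (l * lorentz c a) • klein c σ a +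
      (m * lorentz c b) • klein c σ b) : dist a x + dist x b = dist a b := by
  have hA : Real.cosh (dist a x) = l + m * Real.cosh (dist a b) := by
    rw [cosh_dist_eq (c := c) hσ a x, cosh_dist_eq (c := c) hσ a b]
    have e := lorentz_sq_mul (c := c) hσ a
    have := congrArg (fun v => inner ℝ (klein c σ a) v) h1
    simp only [inner_add_right, inner_smul_right, real_inner_self_eq_norm_sq] at this
    linear_combination lorentz c a * h0 - lorentz c a * this + l * e
  have hC : Real.cosh (dist x b) = l * Real.cosh (dist a b) + m := by
    rw [cosh_dist_eq (c := c) hσ x b, cosh_dist_eq (c := c) hσ a b]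
    have e := lorentz_sq_mul (c := c) hσ b
    have := congrArg (fun v => inner ℝ v (klein c σ b)) h1
    simp only [inner_add_left, real_inner_smul_left, real_inner_self_eq_norm_sq] at this
    linear_combination lorentz c b * h0 - lorentz c b * this + m * e
  have hB : l ^ 2 + m ^ 2 + 2 * l * m * Real.cosh (dist a b) = 1 := by
    rw [cosh_dist_eq (c := c) hσ a b]
    have ea := lorentz_sq_mul (c := c) hσ a
    have eb := lorentz_sq_mul (c := c) hσ b
    have ex := lorentz_sq_mul (c := c) hσ x
    have := congrArg (fun v => inner ℝ v v) h1
    simp only [inner_add_left, inner_add_right, real_inner_smul_left, real_inner_smul_right] at this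
    simp only [real_inner_self_eq_norm_sq] at this
    rw [real_inner_comm (klein c σ a) (klein c σ b)] at this
    linear_combination ex + this - (lorentz c x + l * lorentz c a + m * lorentz c b) * h0 -
      l ^ 2 * ea - m ^ 2 * eb
  have hsA : Real.sinh (dist a x) = m * Real.sinh (dist a b) := by
    refine (pow_left_inj₀ (Real.sinh_nonneg_iff.2 dist_nonneg)
      (mul_nonneg hm (Real.sinh_nonneg_iff.2 dist_nonneg)) two_ne_zero).1 ?_
    rw [mul_pow, Real.sinh_sq, Real.sinh_sq, hA]
    linear_combination hB
  have hsC : Real.sinh (dist x b) = l * Real.sinh (dist a b) := by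
    refine (pow_left_inj₀ (Real.sinh_nonneg_iff.2 dist_nonneg)
      (mul_nonneg hl (Real.sinh_nonneg_iff.2 dist_nonneg)) two_ne_zero).1 ?_
    rw [mul_pow, Real.sinh_sq, Real.sinh_sq, hC]
    linear_combination hB
  have : Real.sinh (dist a x + dist x b) = Real.sinh (dist a b) := by
    rw [Real.sinh_add, hA, hC, hsA, hsC]
    linear_combination Real.sinh (dist a b) * hB
  exact Real.sinh_injective this

/-- The weights are those of hyperbolic interpolation, `sinh (dist x b) / sinh (dist a b)` and `sinh
(dist a x) / sinh (dist a b)`. The difference between `x` and this combination is null and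
orthogonal to the timelike vector `x`, hence zero. -/
theorem exists_comb_of_dist_add_dist_eq (hσ : σ ^ 2 = 1) {a b x : ℍ}
    (h : dist a x + dist x b = dist a b) : ∃ l m : ℝ, 0 ≤ l ∧ 0 ≤ m ∧
    lorentz c x = l * lorentz c a + m * lorentz c b ∧
    lorentz c x • klein c σ x = (l * lorentz c a) • klein c σ a +
      (m * lorentz c b) • klein c σ b := by
  rcases eq_or_ne a b with rfl | hab
  · have : x = a := by
      rw [dist_self, dist_comm] at h
      exact dist_eq_zero.1 (by linarith)
    subst this
    exact ⟨1, 0, zero_le_one, le_rfl, by simp, by simp⟩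
  have hs : 0 < Real.sinh (dist a b) := Real.sinh_pos_iff.2 (dist_pos.2 hab)
  set S := Real.sinh (dist a b) with hS
  set p := dist a x
  set q := dist x b
  set l := Real.sinh q / S
  set m := Real.sinh p / S
  have hlS : l * S = Real.sinh q := div_mul_cancel₀ _ hs.ne'
  have hmS : m * S = Real.sinh p := div_mul_cancel₀ _ hs.ne'
  have hl : 0 ≤ l := div_nonneg (Real.sinh_nonneg_iff.2 dist_nonneg) hs.le
  have hm : 0 ≤ m := div_nonneg (Real.sinh_nonneg_iff.2 dist_nonneg) hs.le
  have hSpq : S = Real.sinh p * Real.cosh q + Real.cosh p * Real.sinh q := by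
    rw [hS, ← h, Real.sinh_add]
  have hA := cosh_dist_eq (c := c) hσ a x
  have hC := cosh_dist_eq (c := c) hσ x b
  have hD := cosh_dist_eq (c := c) hσ a b
  rw [← h, Real.cosh_add] at hD
  have ea := lorentz_sq_mul (c := c) hσ a
  have eb := lorentz_sq_mul (c := c) hσ b
  have ex := lorentz_sq_mul (c := c) hσ x
  have hxY : l * Real.cosh p + m * Real.cosh q = 1 := by
    apply mul_right_cancel₀ hs.ne'
    linear_combination Real.cosh p * hlS + Real.cosh q * hmS - hSpq
  have hYY : l ^ 2 + m ^ 2 + 2 * l * m *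
      (Real.cosh p * Real.cosh q + Real.sinh p * Real.sinh q) = 1 := by
    have e1 := Real.cosh_sq p
    have e2 := Real.cosh_sq q
    apply mul_right_cancel₀ (pow_ne_zero 2 hs.ne')
    have : (l ^ 2 + m ^ 2 + 2 * l * m *
      (Real.cosh p * Real.cosh q + Real.sinh p * Real.sinh q)) * S ^ 2 =
      (l * S) ^ 2 + (m * S) ^ 2 + 2 * (l * S) * (m * S) *
      (Real.cosh p * Real.cosh q + Real.sinh p * Real.sinh q) := by ring
    rw [this, hlS, hmS, one_mul, hSpq]
    linear_combination (-Real.sinh q ^ 2) * e1 - Real.sinh p ^ 2 * e2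
  have key := eq_zero_of_null (w := lorentz c x - (l * lorentz c a + m * lorentz c b))
    (x := lorentz c x) (k := klein c σ x)
    (v := lorentz c x • klein c σ x - ((l * lorentz c a) • klein c σ a +
      (m * lorentz c b) • klein c σ b)) (norm_klein_lt_one hσ x) (lorentz_pos c x).ne' ?_ ?_
  · exact ⟨l, m, hl, hm, sub_eq_zero.1 key.1, sub_eq_zero.1 key.2⟩
  · rw [← real_inner_self_eq_norm_sq] at ea eb ex ⊢
    simp only [inner_sub_left, inner_sub_right, inner_add_left, inner_add_right,
      real_inner_smul_left,
      real_inner_smul_right]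
    rw [real_inner_comm (klein c σ a) (klein c σ x), real_inner_comm (klein c σ b) (klein c σ x),
      real_inner_comm (klein c σ a) (klein c σ b)] at *
    linear_combination ex + l ^ 2 * ea + m ^ 2 * eb - 2 * l * m * hD - 2 * hxY + hYY +
      2 * l * hA + 2 * m * hC
  · simp only [inner_sub_left, inner_add_left, real_inner_smul_left,
      real_inner_smul_right]
    rw [← real_inner_self_eq_norm_sq] at ex
    rw [real_inner_comm (klein c σ b) (klein c σ x)] at *
    linear_combination ex - hxY + l * hA + m * hC

/-- The Klein map turns geodesic segments into Euclidean segments. -/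
theorem mem_segment_iff (hσ : σ ^ 2 = 1) {a b x : ℍ} :
    x ∈ segment a b ↔ klein c σ x ∈ _root_.segment ℝ (klein c σ a) (klein c σ b) := by
  have ha := lorentz_pos c a
  have hb := lorentz_pos c b
  have hx := lorentz_pos c x
  constructor
  · intro h
    obtain ⟨l, m, hl, hm, h0, h1⟩ := exists_comb_of_dist_add_dist_eq (c := c) hσ h
    refine ⟨l * lorentz c a / lorentz c x, m * lorentz c b / lorentz c x, by positivity,
      by positivity, ?_, ?_⟩
    · rw [← add_div, ← h0, div_self hx.ne']
    · apply smul_right_injective ℂ hx.ne'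
      simp only [h1, smul_add, smul_smul]
      rw [mul_div_cancel₀ _ hx.ne', mul_div_cancel₀ _ hx.ne']
  · rintro ⟨s, t, hs, ht, hst, h⟩
    refine dist_add_dist_eq_of_comb (c := c) hσ (l := lorentz c x * s / lorentz c a)
      (m := lorentz c x * t / lorentz c b) (by positivity) (by positivity) ?_ ?_
    · rw [div_mul_cancel₀ _ ha.ne', div_mul_cancel₀ _ hb.ne', ← mul_add, hst, mul_one]
    · rw [div_mul_cancel₀ _ ha.ne', div_mul_cancel₀ _ hb.ne', ← h, smul_add, smul_smul, smul_smul]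

end

/-! ### Oriented angles in the Klein model -/

section

variable {c : ℍ} {σ : ℝ}

theorem lorentz_mul_klein_re (z : ℍ) :
    lorentz c z * (klein c σ z).re = (z.re - c.re) / z.im := by
  have h1 := z.im_pos
  have h2 := c.im_pos
  have h3 := kleinDenom_pos c z
  simp only [klein, lorentz]
  field_simp

theorem lorentz_mul_klein_im (z : ℍ) : lorentz c z * (klein c σ z).im =
    σ * (((z.re - c.re) ^ 2 + z.im ^ 2 - c.im ^ 2) / (2 * c.im * z.im)) := by
  have h1 := z.im_pos
  have h2 := c.im_pos
  have h3 := kleinDenom_pos c z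
  simp only [klein, lorentz]
  field_simp

theorem direction_eq (z w : ℍ) : direction z w =
    ⟨((w.re - z.re) ^ 2 + w.im ^ 2 - z.im ^ 2) / ((w.re - z.re) ^ 2 + (w.im + z.im) ^ 2),
      -2 * z.im * (w.re - z.re) / ((w.re - z.re) ^ 2 + (w.im + z.im) ^ 2)⟩ := by
  have h1 := z.im_pos
  have h2 := w.im_pos
  have h3 : 0 < (w.re - z.re) ^ 2 + (w.im + z.im) ^ 2 := by positivity
  have h4 : (w : ℂ) - (starRingEnd ℂ) (z : ℂ) ≠ 0 := by
    intro h
    have := congrArg Complex.im h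
    simp at this
    linarith
  rw [direction, div_eq_iff h4]
  apply Complex.ext <;> simp <;> field_simp <;> ring

theorem cosh_dist_add_one (z w : ℍ) : Real.cosh (dist z w) + 1 =
    ((w.re - z.re) ^ 2 + (w.im + z.im) ^ 2) / (2 * z.im * w.im) := by
  have h1 := z.im_pos
  have h4 := w.im_pos
  have h6 : dist (z : ℂ) w ^ 2 = (z.re - w.re) ^ 2 + (z.im - w.im) ^ 2 := by
    rw [dist_eq_norm, norm_sq_eq_re_add_im]; simp
  rw [UpperHalfPlane.cosh_dist, h6]
  field_simp
  ring

/-- By the law of cosines the left side is `sinh * sinh * cos` of the angle at `z`. The bracket on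
the right is the Klein metric at `z`, divided by `lorentz c z ^ 2`, of the vectors towards `u` and
`w`. -/
theorem cosh_mul_cosh_sub_cosh (hσ : σ ^ 2 = 1) (z u w : ℍ) :
    Real.cosh (dist z u) * Real.cosh (dist z w) - Real.cosh (dist u w) =
    lorentz c u * lorentz c w *
      (inner ℝ (klein c σ u - klein c σ z) (klein c σ w - klein c σ z) +
        lorentz c z ^ 2 * inner ℝ (klein c σ z) (klein c σ u - klein c σ z) *
          inner ℝ (klein c σ z) (klein c σ w - klein c σ z)) := by
  have e := lorentz_sq_mul (c := c) hσ z
  rw [cosh_dist_eq (c := c) hσ z u, cosh_dist_eq (c := c) hσ z w, cosh_dist_eq (c := c) hσ u w]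
  rw [← real_inner_self_eq_norm_sq] at e
  simp only [inner_sub_left, inner_sub_right]
  rw [real_inner_comm (klein c σ z) (klein c σ u)]
  linear_combination (lorentz c u * lorentz c w) * (1 - inner ℝ (klein c σ z) (klein c σ u) -
    inner ℝ (klein c σ z) (klein c σ w) + inner ℝ (klein c σ z) (klein c σ z)) * e

theorem direction_mul_conj_re (z u w : ℍ) :
    (direction z w * (starRingEnd ℂ) (direction z u)).re =
      (Real.cosh (dist z u) * Real.cosh (dist z w) - Real.cosh (dist u w)) /
        ((Real.cosh (dist z u) + 1) * (Real.cosh (dist z w) + 1)) := by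
  have h1 := z.im_pos
  have h2 := u.im_pos
  have h3 := w.im_pos
  have e1 := cosh_dist_add_one z u
  have e2 := cosh_dist_add_one z w
  have e3 := cosh_dist_add_one u w
  rw [e1, e2, eq_sub_of_add_eq e1, eq_sub_of_add_eq e2, eq_sub_of_add_eq e3, direction_eq,
    direction_eq]
  have h5 : 0 < (w.re - z.re) ^ 2 + (w.im + z.im) ^ 2 := by positivity
  have h6 : 0 < (u.re - z.re) ^ 2 + (u.im + z.im) ^ 2 := by positivity
  simp
  field_simp
  ring

/-- The cross product in the plane. -/
def cross (d e : ℂ) : ℝ := d.re * e.im - d.im * e.re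

/-- Multiplied by the three Lorentz factors, the cross product is the determinant of the three
hyperboloid vectors, which `key` expands. The factor `σ` compensates for a reversal of orientation
by the Klein map. -/
theorem direction_mul_conj_im (hσ : σ ^ 2 = 1) (z u w : ℍ) :
    (direction z w * (starRingEnd ℂ) (direction z u)).im =
      lorentz c u * lorentz c w *
      (σ * lorentz c z * cross (klein c σ u - klein c σ z) (klein c σ w - klein c σ z)) /
        ((Real.cosh (dist z u) + 1) * (Real.cosh (dist z w) + 1)) := by
  have h1 := z.im_pos
  have h2 := u.im_pos
  have h3 := w.im_pos
  have h4 := c.im_pos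
  have e1 := cosh_dist_add_one z u
  have e2 := cosh_dist_add_one z w
  have key : lorentz c u * lorentz c w *
      (σ * lorentz c z * cross (klein c σ u - klein c σ z) (klein c σ w - klein c σ z)) =
      σ * (lorentz c z * ((lorentz c u * (klein c σ u).re) * (lorentz c w * (klein c σ w).im) -
        (lorentz c u * (klein c σ u).im) * (lorentz c w * (klein c σ w).re)) -
      lorentz c u * ((lorentz c z * (klein c σ z).re) * (lorentz c w * (klein c σ w).im) -
        (lorentz c z * (klein c σ z).im) * (lorentz c w * (klein c σ w).re)) +
      lorentz c w * ((lorentz c z * (klein c σ z).re) * (lorentz c u * (klein c σ u).im) -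
        (lorentz c z * (klein c σ z).im) * (lorentz c u * (klein c σ u).re))) := by
    simp only [cross, Complex.sub_re, Complex.sub_im]
    ring
  rw [key]
  simp only [lorentz_mul_klein_re, lorentz_mul_klein_im]
  simp only [lorentz, kleinDenom]
  have key2 : ∀ A B C D E F G H J K L M : ℝ, σ * (A * (B * (σ * C) - (σ * D) * E) -
      F * (G * (σ * H) - (σ * J) * K) + L * (G * (σ * D) - (σ * J) * M)) =
      (A * (B * C - D * E) - F * (G * H - J * K) + L * (G * D - J * M)) := by
    intro A B C D E F G H J K L M
    linear_combination (A * (B * C - D * E) - F * (G * H - J * K) + L * (G * D - J * M)) * hσ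
  rw [key2]
  rw [e1, e2, direction_eq, direction_eq]
  have h5 : 0 < (w.re - z.re) ^ 2 + (w.im + z.im) ^ 2 := by positivity
  have h6 : 0 < (u.re - z.re) ^ 2 + (u.im + z.im) ^ 2 := by positivity
  simp
  field_simp
  ring

/-- The complex number whose argument is the angle at `k` between the vectors `d` and `e`, with
respect to the metric of the Klein model. -/
def kleinAngle (σ l : ℝ) (k d e : ℂ) : ℂ :=
  ⟨inner ℝ d e + l ^ 2 * inner ℝ k d * inner ℝ k e, σ * l * cross d e⟩

/-- The quotient of the two directions is a positive real multiple of `kleinAngle`, by the two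
preceding formulas for its real and imaginary parts. -/
theorem orientedAngle_eq_arg (hσ : σ ^ 2 = 1) {u z w : ℍ} (hu : u ≠ z) :
    orientedAngle u z w = ((kleinAngle σ (lorentz c z) (klein c σ z)
      (klein c σ u - klein c σ z) (klein c σ w - klein c σ z)).arg : Real.Angle) := by
  have hd : direction z u ≠ 0 := by
    have h4 : (u : ℂ) - (starRingEnd ℂ) (z : ℂ) ≠ 0 := by
      intro h
      have := congrArg Complex.im h
      simp at this
      linarith [z.im_pos, u.im_pos]
    refine div_ne_zero (sub_ne_zero.2 fun h => hu (UpperHalfPlane.ext h)) h4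
  have hpos : 0 < Complex.normSq (direction z u) := Complex.normSq_pos.2 hd
  have e1 : direction z w / direction z u =
      ((lorentz c u * lorentz c w / ((Real.cosh (dist z u) + 1) * (Real.cosh (dist z w) + 1))
        / Complex.normSq (direction z u) : ℝ) : ℂ) * kleinAngle σ (lorentz c z) (klein c σ z)
      (klein c σ u - klein c σ z) (klein c σ w - klein c σ z) := by
    have : direction z w / direction z u = ((Complex.normSq (direction z u))⁻¹ : ℝ) *
      (direction z w * (starRingEnd ℂ) (direction z u)) := by
      rw [div_eq_mul_inv, Complex.inv_def]; ring
    rw [this]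
    apply Complex.ext
    · rw [Complex.re_ofReal_mul, Complex.re_ofReal_mul, direction_mul_conj_re,
        cosh_mul_cosh_sub_cosh (c := c) hσ]
      simp only [kleinAngle]
      ring
    · rw [Complex.im_ofReal_mul, Complex.im_ofReal_mul, direction_mul_conj_im (c := c) hσ]
      simp only [kleinAngle]
      ring
  rw [orientedAngle, e1, Complex.arg_real_mul]
  have := lorentz_pos c u
  have := lorentz_pos c w
  have := Real.one_le_cosh (dist z u)
  have := Real.one_le_cosh (dist z w)
  positivity

end

/-! ### Hyperbolic area in Klein coordinates -/

section

variable {c : ℍ} {σ : ℝ}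

/-- The Klein map in real coordinates. -/
def kleinReal (c : ℍ) (σ : ℝ) (v : ℝ × ℝ) : ℝ × ℝ :=
  (2 * c.im * (v.1 - c.re) / (c.im ^ 2 + (v.1 - c.re) ^ 2 + v.2 ^ 2),
    σ * ((v.1 - c.re) ^ 2 + v.2 ^ 2 - c.im ^ 2) / (c.im ^ 2 + (v.1 - c.re) ^ 2 + v.2 ^ 2))

/-- The derivative of `kleinReal`. -/
def kleinRealDeriv (c : ℍ) (σ : ℝ) (v : ℝ × ℝ) : ℝ × ℝ →L[ℝ] ℝ × ℝ :=
  (Matrix.toLin (.finTwoProd ℝ) (.finTwoProd ℝ)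
    (let N := c.im ^ 2 + (v.1 - c.re) ^ 2 + v.2 ^ 2;
      !![2 * c.im * (c.im ^ 2 + v.2 ^ 2 - (v.1 - c.re) ^ 2) / N ^ 2,
        -4 * c.im * (v.1 - c.re) * v.2 / N ^ 2;
          σ * (4 * c.im ^ 2 * (v.1 - c.re)) / N ^ 2,
        σ * (4 * c.im ^ 2 * v.2) / N ^ 2])).toContinuousLinearMap

theorem hasFDerivAt_kleinReal (c : ℍ) (σ : ℝ) (v : ℝ × ℝ) :
    HasFDerivAt (kleinReal c σ) (kleinRealDeriv c σ v) v := by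
  have hb := c.im_pos
  have hN : c.im ^ 2 + (v.1 - c.re) ^ 2 + v.2 ^ 2 ≠ 0 := by positivity
  have hx : HasFDerivAt (fun v : ℝ × ℝ => v.1 - c.re) (ContinuousLinearMap.fst ℝ ℝ ℝ) v :=
    hasFDerivAt_fst.sub_const _
  have hy : HasFDerivAt (fun v : ℝ × ℝ => v.2) (ContinuousLinearMap.snd ℝ ℝ ℝ) v :=
    hasFDerivAt_snd
  have hD := ((hx.pow 2).const_add (c.im ^ 2)).add (hy.pow 2)
  have h1 := (hx.const_mul (2 * c.im)).mul ((hasDerivAt_inv hN).comp_hasFDerivAt v hD)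
  have h2 := ((((hx.pow 2).add (hy.pow 2)).sub_const (c.im ^ 2)).const_mul σ).mul
    ((hasDerivAt_inv hN).comp_hasFDerivAt v hD)
  have h := h1.prodMk h2
  unfold kleinRealDeriv
  rw [Matrix.toLin_finTwoProd_toContinuousLinearMap]
  refine HasFDerivAt.congr_fderiv h ?_
  ext <;> simp <;> field_simp <;> ring

theorem det_kleinRealDeriv (c : ℍ) (σ : ℝ) (v : ℝ × ℝ) :
    (kleinRealDeriv c σ v).det =
      σ * (8 * c.im ^ 3 * v.2) / (c.im ^ 2 + (v.1 - c.re) ^ 2 + v.2 ^ 2) ^ 3 := by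
  have hb := c.im_pos
  have hN : c.im ^ 2 + (v.1 - c.re) ^ 2 + v.2 ^ 2 ≠ 0 := by positivity
  unfold kleinRealDeriv
  simp only [LinearMap.det_toContinuousLinearMap,
    LinearMap.det_toLin, Matrix.det_fin_two_of]
  field_simp
  ring

/-- The density of the hyperbolic area in the Klein model. -/
def kleinDensity (v : ℝ × ℝ) : ℝ := (√(1 - v.1 ^ 2 - v.2 ^ 2) ^ 3)⁻¹

theorem klein_eq_kleinReal (z : ℍ) :
    Complex.measurableEquivRealProd (klein c σ z) =
      kleinReal c σ (Complex.measurableEquivRealProd z) := rfl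

theorem volume_preimage_klein (hσ : σ ^ 2 = 1) {A : Set (ℝ × ℝ)} (hA : MeasurableSet A)
    (hA1 : ∀ v ∈ A, v.1 ^ 2 + v.2 ^ 2 < 1) :
    volume (klein c σ ⁻¹' (Complex.measurableEquivRealProd ⁻¹' A)) =
      ∫⁻ v in A, ENNReal.ofReal (kleinDensity v) := by
  set S := klein c σ ⁻¹' (Complex.measurableEquivRealProd ⁻¹' A) with hS
  have hSm : MeasurableSet S :=
    continuous_klein.measurable (Complex.measurableEquivRealProd.measurable hA)
  have hSm' : MeasurableSet ((↑) '' S : Set ℂ) :=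
    UpperHalfPlane.measurableEmbedding_coe.measurableSet_image.2 hSm
  set B : Set (ℝ × ℝ) := Complex.measurableEquivRealProd '' ((↑) '' S) with hB
  have hBm : MeasurableSet B := Complex.measurableEquivRealProd.measurableSet_image.2 hSm'
  have hBA : kleinReal c σ '' B = A := by
    ext v
    constructor
    · rintro ⟨_, ⟨_, ⟨z, hz, rfl⟩, rfl⟩, rfl⟩
      rw [← klein_eq_kleinReal]
      exact hz
    · intro hv
      have hk : ‖Complex.measurableEquivRealProd.symm v‖ < 1 := by
        have h1 := hA1 v hv
        have h2 : ‖Complex.measurableEquivRealProd.symm v‖ ^ 2 < 1 := by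
          rw [norm_sq_eq_re_add_im]; exact h1
        nlinarith [norm_nonneg (Complex.measurableEquivRealProd.symm v)]
      obtain ⟨z, hz⟩ := exists_klein_eq (c := c) hσ hk
      refine ⟨Complex.measurableEquivRealProd z, ⟨z, ⟨z, ?_, rfl⟩, rfl⟩, ?_⟩
      · simpa [hS, hz] using hv
      · rw [← klein_eq_kleinReal, hz]; simp
  have hBy : ∀ v ∈ B, 0 < v.2 := by
    rintro _ ⟨_, ⟨z, hz, rfl⟩, rfl⟩
    exact z.im_pos
  have hinj : Set.InjOn (kleinReal c σ) B := by
    rintro _ ⟨_, ⟨z, hz, rfl⟩, rfl⟩ _ ⟨_, ⟨w, hw, rfl⟩, rfl⟩ h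
    rw [← klein_eq_kleinReal, ← klein_eq_kleinReal] at h
    rw [klein_injective hσ (Complex.measurableEquivRealProd.injective h)]
  have e1 : volume S = ∫⁻ v in B, ENNReal.ofReal (1 / v.2 ^ 2) := by
    rw [UpperHalfPlane.volume_eq_lintegral, hB,
      ← Complex.volume_preserving_equiv_real_prod.setLIntegral_comp_emb
        Complex.measurableEquivRealProd.measurableEmbedding]
    refine lintegral_congr fun z => ?_
    rw [ENNReal.ofReal]
    congr 1
    ext
    simp [Complex.measurableEquivRealProd_apply]
    positivity
  rw [e1]
  rw [← hBA, lintegral_image_eq_lintegral_abs_det_fderiv_mul volume hBm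
    (fun v _ => (hasFDerivAt_kleinReal c σ v).hasFDerivWithinAt) hinj]
  refine setLIntegral_congr_fun hBm fun v hv => ?_
  have hy := hBy v hv
  have hb := c.im_pos
  have hN : 0 < c.im ^ 2 + (v.1 - c.re) ^ 2 + v.2 ^ 2 := by positivity
  have hsig : |σ| = 1 := by rw [← sq_eq_sq₀ (abs_nonneg _) zero_le_one, sq_abs, hσ, one_pow]
  rw [← ENNReal.ofReal_mul (abs_nonneg _)]
  congr 1
  rw [det_kleinRealDeriv, abs_div, abs_mul, hsig, kleinDensity]
  -- This root is the reciprocal of the Lorentz factor. Its inverse cube cancels the Jacobian up to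
  -- the factor `1 / y ^ 2`, the density of the half-plane.
  have : √(1 - (kleinReal c σ v).1 ^ 2 - (kleinReal c σ v).2 ^ 2) =
      2 * c.im * v.2 / (c.im ^ 2 + (v.1 - c.re) ^ 2 + v.2 ^ 2) := by
    rw [Real.sqrt_eq_iff_mul_self_eq_of_pos (by positivity)]
    simp only [kleinReal, mul_div_assoc, mul_pow, hσ]
    field_simp
    ring
  rw [this, abs_of_pos (by positivity), abs_of_pos (by positivity)]
  field_simp
  norm_num

end

/-! ### Area of a star-shaped region in polar coordinates -/

section

theorem hasDerivAt_inv_sqrt_one_sub_sq {s : ℝ} (hs : s ^ 2 < 1) :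
    HasDerivAt (fun s : ℝ => (√(1 - s ^ 2))⁻¹) (s * (√(1 - s ^ 2) ^ 3)⁻¹) s := by
  have h0 : 0 < 1 - s ^ 2 := by linarith
  have h1 : HasDerivAt (fun s : ℝ => 1 - s ^ 2) (-(2 * s)) s := by
    simpa using (hasDerivAt_pow 2 s).const_sub 1
  have h2 := (h1.sqrt h0.ne').inv (Real.sqrt_pos.2 h0).ne'
  refine h2.congr_deriv ?_
  have := Real.sqrt_pos.2 h0
  field_simp

theorem integral_radial {ρ : ℝ} (h0 : 0 < ρ) (h1 : ρ < 1) :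
    ∫ s in (0 : ℝ)..ρ, s * (√(1 - s ^ 2) ^ 3)⁻¹ = (√(1 - ρ ^ 2))⁻¹ - 1 := by
  have hs : ∀ s ∈ Set.uIcc 0 ρ, s ^ 2 < 1 := by
    intro s hs
    rw [Set.uIcc_of_le h0.le] at hs
    nlinarith [hs.1, hs.2]
  rw [intervalIntegral.integral_eq_sub_of_hasDerivAt
    (fun s h => hasDerivAt_inv_sqrt_one_sub_sq (hs s h))]
  · simp
  · refine ContinuousOn.intervalIntegrable (ContinuousOn.mul continuousOn_id
      (ContinuousOn.inv₀ (by fun_prop) fun s h => ?_))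
    have := hs s h
    exact pow_ne_zero 3 (Real.sqrt_pos.2 (by linarith)).ne'

theorem lintegral_radial {ρ : ℝ} (h0 : 0 < ρ) (h1 : ρ < 1) :
    ∫⁻ s in Set.Ioc 0 ρ, ENNReal.ofReal (s * (√(1 - s ^ 2) ^ 3)⁻¹) =
      ENNReal.ofReal ((√(1 - ρ ^ 2))⁻¹ - 1) := by
  rw [← integral_radial h0 h1, intervalIntegral.integral_of_le h0.le,
    ofReal_integral_eq_lintegral_ofReal]
  · rw [← IntegrableOn, ← intervalIntegrable_iff_integrableOn_Ioc_of_le h0.le]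
    refine ContinuousOn.intervalIntegrable (ContinuousOn.mul continuousOn_id
      (ContinuousOn.inv₀ (by fun_prop) fun s hs => ?_))
    rw [Set.uIcc_of_le h0.le] at hs
    exact pow_ne_zero 3 (Real.sqrt_pos.2 (by nlinarith [hs.1, hs.2])).ne'
  · refine (ae_restrict_iff' measurableSet_Ioc).2 (Filter.Eventually.of_forall fun s hs => ?_)
    have := hs.1
    simp only [Pi.zero_apply]
    positivity

/-- The hyperbolic area of a star-shaped region, in polar coordinates of the Klein model. -/
theorem lintegral_kleinDensity_of_starShaped {ρ : ℝ → ℝ} (hρ : Continuous ρ) (h0 : ∀ θ, 0 < ρ θ)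
    (h1 : ∀ θ, ρ θ < 1) {A : Set (ℝ × ℝ)} (hA : MeasurableSet A)
    (hAρ : ∀ s θ, 0 < s → ((s * Real.cos θ, s * Real.sin θ) ∈ A ↔ s ≤ ρ θ)) :
    ∫⁻ v in A, ENNReal.ofReal (kleinDensity v) =
      ENNReal.ofReal (∫ θ in (-Real.pi)..Real.pi, ((√(1 - ρ θ ^ 2))⁻¹ - 1)) := by
  have hmeas : Measurable fun v : ℝ × ℝ => ENNReal.ofReal (kleinDensity v) := by
    unfold kleinDensity; fun_prop
  rw [← lintegral_indicator hA, ← lintegral_comp_polarCoord_symm, polarCoord_target,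
    Measure.volume_eq_prod, setLIntegral_prod_symm]
  · have inner : ∀ θ : ℝ, ∫⁻ s in Set.Ioi (0 : ℝ), ENNReal.ofReal (s, θ).1 •
        A.indicator (fun v => ENNReal.ofReal (kleinDensity v)) (polarCoord.symm (s, θ)) =
        ENNReal.ofReal ((√(1 - ρ θ ^ 2))⁻¹ - 1) := by
      intro θ
      rw [← lintegral_radial (h0 θ) (h1 θ), ← lintegral_indicator measurableSet_Ioi,
        ← lintegral_indicator measurableSet_Ioc]
      refine lintegral_congr fun s => ?_
      by_cases hs : 0 < s
      · rw [Set.indicator_of_mem (Set.mem_Ioi.2 hs), polarCoord_symm_apply]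
        by_cases hsρ : s ≤ ρ θ
        · rw [Set.indicator_of_mem (Set.mem_Ioc.2 ⟨hs, hsρ⟩), Set.indicator_of_mem
            ((hAρ s θ hs).2 hsρ), smul_eq_mul, ← ENNReal.ofReal_mul hs.le, kleinDensity]
          have : 1 - (s * Real.cos θ) ^ 2 - (s * Real.sin θ) ^ 2 = 1 - s ^ 2 := by
            linear_combination (-s ^ 2) * Real.sin_sq_add_cos_sq θ
          simp only [this]
        · rw [Set.indicator_of_notMem (fun h => hsρ (Set.mem_Ioc.1 h).2), Set.indicator_of_notMem
            (fun h => hsρ ((hAρ s θ hs).1 h)), smul_zero]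
      · rw [Set.indicator_of_notMem (fun h => hs (Set.mem_Ioi.1 h)),
          Set.indicator_of_notMem fun h => hs (Set.mem_Ioc.1 h).1]
    simp only [inner]
    have hpos : ∀ θ, 0 < 1 - ρ θ ^ 2 := fun θ => by nlinarith [h0 θ, h1 θ]
    have hcont : Continuous fun θ => (√(1 - ρ θ ^ 2))⁻¹ - 1 :=
      (Continuous.inv₀ (by fun_prop) fun θ => (Real.sqrt_pos.2 (hpos θ)).ne').sub
        continuous_const
    rw [intervalIntegral.integral_of_le (by linarith [Real.pi_pos]),
      ofReal_integral_eq_lintegral_ofReal, restrict_Ioo_eq_restrict_Ioc]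
    · exact hcont.integrableOn_Ioc
    · refine Filter.Eventually.of_forall fun θ => sub_nonneg.2 ?_
      rw [one_le_inv₀ (Real.sqrt_pos.2 (hpos θ))]
      exact Real.sqrt_le_iff.2 ⟨zero_le_one, by nlinarith [h0 θ]⟩
  · refine AEMeasurable.mul (by fun_prop) ?_
    exact ((hmeas.indicator hA).comp continuous_polarCoord_symm.measurable).aemeasurable

end

/-! ### Cycles of tangency points and their winding number -/

section

theorem sum_range_natCast_zmod {n : ℕ} [NeZero n] (f : ZMod n → ℝ) :
    ∑ l ∈ Finset.range n, f (l : ZMod n) = ∑ i, f i := by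
  refine Finset.sum_nbij' (fun l => (l : ZMod n)) ZMod.val ?_ ?_ ?_ ?_ ?_
  · simp
  · intro i _; simpa using ZMod.val_lt i
  · intro l hl; exact ZMod.val_cast_of_lt (Finset.mem_range.1 hl)
  · intro i _; exact ZMod.natCast_zmod_val i
  · simp

theorem natCast_zmod_ne_zero {n d : ℕ} (h0 : 0 < d) (h1 : d < n) : (d : ZMod n) ≠ 0 := by
  rw [Ne, ZMod.natCast_eq_zero_iff]
  exact fun h => absurd (Nat.le_of_dvd h0 h) (by omega)

theorem mem_segment_mul_one_add {R a b t : ℝ} {u : ℂ} (ha : -a ≤ t) (hb : t ≤ b) :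
    (R : ℂ) * u * (1 + t * Complex.I) ∈ _root_.segment ℝ ((R : ℂ) * u * (1 - a * Complex.I))
      ((R : ℂ) * u * (1 + b * Complex.I)) := by
  have h := image_segment ℝ (AffineMap.lineMap ((R : ℂ) * u) ((R : ℂ) * u * (1 + Complex.I)))
    (-a) b
  have e : ∀ t : ℝ, (AffineMap.lineMap ((R : ℂ) * u) ((R : ℂ) * u * (1 + Complex.I)) : ℝ →ᵃ[ℝ] ℂ) t
      = (R : ℂ) * u * (1 + t * Complex.I) := by
    intro t
    rw [AffineMap.lineMap_apply_module]
    simp only [Complex.real_smul]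
    push_cast
    ring
  rw [e, e] at h
  have e2 : (R : ℂ) * u * (1 + ((-a : ℝ) : ℂ) * Complex.I) = (R : ℂ) * u * (1 - a * Complex.I) := by
    push_cast; ring
  rw [e2] at h
  rw [← h, ← e t]
  refine Set.mem_image_of_mem _ ?_
  rw [segment_eq_Icc (ha.trans hb)]
  exact ⟨ha, hb⟩

theorem cos_le_cos_of_dist {x d : ℝ} (hd : 0 ≤ d) (h1 : d ≤ x) (h2 : x ≤ 2 * Real.pi - d) :
    Real.cos x ≤ Real.cos d := by
  rcases le_total x Real.pi with h | h
  · exact Real.cos_le_cos_of_nonneg_of_le_pi hd h h1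
  · rw [← Real.cos_two_pi_sub x]
    exact Real.cos_le_cos_of_nonneg_of_le_pi hd (by linarith) (by linarith)

theorem one_add_tan_mul_I {x : ℝ} (hx : Real.cos x ≠ 0) :
    (1 + (Real.tan x : ℂ) * Complex.I) = Complex.exp (x * Complex.I) / (Real.cos x : ℂ) := by
  have : (Real.cos x : ℂ) ≠ 0 := by exact_mod_cast hx
  rw [Real.tan_eq_sin_div_cos, Complex.exp_mul_I, ← Complex.ofReal_cos, ← Complex.ofReal_sin,
    Complex.ofReal_div]
  field_simp

theorem inner_exp_exp (x y : ℝ) :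
    inner ℝ (Complex.exp (x * Complex.I)) (Complex.exp (y * Complex.I)) = Real.cos (x - y) := by
  rw [inner_eq_re_add_im, Complex.exp_ofReal_mul_I_re, Complex.exp_ofReal_mul_I_re,
    Complex.exp_ofReal_mul_I_im, Complex.exp_ofReal_mul_I_im, Real.cos_sub]

/-- A cyclic sequence of points on the unit circle, in which the next point is obtained by a
counterclockwise rotation by less than `π`. -/
structure TangentCycle (n : ℕ) where
  point : ZMod n → ℂ
  halfAngle : ZMod n → ℝ
  norm_point : ∀ i, ‖point i‖ = 1
  halfAngle_nonneg : ∀ i, 0 ≤ halfAngle i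
  halfAngle_lt : ∀ i, halfAngle i < Real.pi / 2
  point_succ : ∀ i, point (i + 1) = point i * Complex.exp ((2 * halfAngle (i + 1) : ℝ) * Complex.I)

namespace TangentCycle

variable {n : ℕ} (C : TangentCycle n)

/-- The vertex between the tangents of the circle of radius `R` at the points `i - 1` and `i`. -/
def vertex (R : ℝ) (i : ZMod n) : ℂ :=
  R * C.point i * (1 - Real.tan (C.halfAngle i) * Complex.I)

/-- The lift of the arguments of the points to the real line. -/
def lift : ℕ → ℝ
  | 0 => (C.point 0).arg
  | j + 1 => lift j + 2 * C.halfAngle ((j + 1 : ℕ) : ZMod n)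

theorem lift_succ (j : ℕ) :
    C.lift (j + 1) = C.lift j + 2 * C.halfAngle ((j + 1 : ℕ) : ZMod n) := rfl

theorem cos_halfAngle_pos (i : ZMod n) : 0 < Real.cos (C.halfAngle i) :=
  Real.cos_pos_of_mem_Ioo ⟨by linarith [C.halfAngle_nonneg i, Real.pi_pos], C.halfAngle_lt i⟩

theorem point_eq_exp (j : ℕ) : C.point (j : ZMod n) = Complex.exp (C.lift j * Complex.I) := by
  induction j with
  | zero =>
    have := Complex.norm_mul_exp_arg_mul_I (C.point 0)
    rw [C.norm_point] at this
    simpa [lift] using this.symm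
  | succ j ih =>
    rw [lift_succ, Complex.ofReal_add, add_mul, Complex.exp_add, ← ih]
    have := C.point_succ j
    push_cast at *
    exact this

theorem vertex_succ (R : ℝ) (i : ZMod n) :
    C.vertex R (i + 1) = R * C.point i * (1 + Real.tan (C.halfAngle (i + 1)) * Complex.I) := by
  set a := C.halfAngle (i + 1) with ha
  have hc : Real.cos a ≠ 0 := (C.cos_halfAngle_pos (i + 1)).ne'
  have h1 := one_add_tan_mul_I hc
  have h2 : (1 - (Real.tan a : ℂ) * Complex.I) =
      Complex.exp (-a * Complex.I) / (Real.cos a : ℂ) := by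
    have := one_add_tan_mul_I (x := -a) (by rwa [Real.cos_neg])
    rw [Real.tan_neg, Real.cos_neg] at this
    push_cast at this ⊢
    rw [← this]; ring
  rw [vertex, C.point_succ, ← ha, h1, h2]
  have : Complex.exp ((2 * a : ℝ) * Complex.I) * Complex.exp (-a * Complex.I) =
      Complex.exp (a * Complex.I) := by
    rw [← Complex.exp_add]; congr 1; push_cast; ring
  rw [← this]; ring

theorem lift_mono : Monotone C.lift :=
  monotone_nat_of_le_succ fun j => by
    rw [lift_succ]; linarith [C.halfAngle_nonneg ((j + 1 : ℕ) : ZMod n)]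

theorem lift_add (j m : ℕ) : C.lift (j + m) =
    C.lift j + ∑ l ∈ Finset.range m, 2 * C.halfAngle ((j + 1 + l : ℕ) : ZMod n) := by
  induction m with
  | zero => simp
  | succ m ih =>
    rw [← add_assoc, lift_succ, ih, Finset.sum_range_succ, add_right_comm j m 1, add_assoc]

theorem lift_add_card [NeZero n] (j : ℕ) :
    C.lift (j + n) = C.lift j + 2 * ∑ i, C.halfAngle i := by
  rw [lift_add, ← Finset.mul_sum]
  have := sum_range_natCast_zmod (fun i : ZMod n => C.halfAngle (((j + 1 : ℕ) : ZMod n) + i))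
  rw [Fintype.sum_equiv (Equiv.addLeft ((j + 1 : ℕ) : ZMod n))
    (fun i : ZMod n => C.halfAngle (((j + 1 : ℕ) : ZMod n) + i)) C.halfAngle (fun i => rfl)] at this
  rw [← this]
  push_cast
  rfl

/-- After `n` steps the lift represents the same point of the circle, so it has grown by a multiple
of `2 * π`. -/
theorem exists_sum_halfAngle [NeZero n] : ∃ k : ℤ, ∑ i, C.halfAngle i = k * Real.pi := by
  have h1 := C.point_eq_exp 0
  have h2 := C.point_eq_exp (0 + n)
  rw [lift_add_card] at h2
  simp only [zero_add, ZMod.natCast_self] at h2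
  simp only [Nat.cast_zero] at h1
  rw [h1, Complex.exp_eq_exp_iff_exists_int] at h2
  obtain ⟨k, hk⟩ := h2
  refine ⟨-k, ?_⟩
  have h3 := congrArg Complex.im hk
  simp at h3
  push_cast
  linarith

/-- The tangents at two points `2 * δ` apart meet at distance `R * tan δ` from both points of
tangency. The half angles are large enough for both sides to reach that far. -/
theorem not_disjoint_sides {R δ : ℝ} {i j : ZMod n} (h0 : 0 ≤ δ)
    (hδ : C.point j = C.point i * Complex.exp ((2 * δ : ℝ) * Complex.I))
    (hi : δ ≤ C.halfAngle (i + 1)) (hj : δ ≤ C.halfAngle j) :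
    ¬ Disjoint (_root_.segment ℝ (C.vertex R i) (C.vertex R (i + 1)))
      (_root_.segment ℝ (C.vertex R j) (C.vertex R (j + 1))) := by
  have hδ2 : δ < Real.pi / 2 := hj.trans_lt (C.halfAngle_lt j)
  have htan : ∀ l : ZMod n, 0 ≤ Real.tan (C.halfAngle l) := fun l =>
    Real.tan_nonneg_of_nonneg_of_le_pi_div_two (C.halfAngle_nonneg l) (C.halfAngle_lt l).le
  have htδ : 0 ≤ Real.tan δ := Real.tan_nonneg_of_nonneg_of_le_pi_div_two h0 hδ2.le
  have htl : ∀ l : ZMod n, δ ≤ C.halfAngle l → Real.tan δ ≤ Real.tan (C.halfAngle l) := fun l h =>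
    Real.strictMonoOn_tan.monotoneOn ⟨by linarith [Real.pi_pos], hδ2⟩
      ⟨by linarith [Real.pi_pos, C.halfAngle_nonneg l], C.halfAngle_lt l⟩ h
  have hcos : Real.cos δ ≠ 0 := (Real.cos_pos_of_mem_Ioo ⟨by linarith, hδ2⟩).ne'
  rw [Set.not_disjoint_iff]
  refine ⟨R * C.point i * (1 + Real.tan δ * Complex.I), ?_, ?_⟩
  · rw [vertex_succ]
    exact mem_segment_mul_one_add (by linarith [htan i]) (htl _ hi)
  · have e : (R : ℂ) * C.point i * (1 + Real.tan δ * Complex.I) =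
        R * C.point j * (1 + (Real.tan (-δ) : ℝ) * Complex.I) := by
      rw [hδ, one_add_tan_mul_I hcos, one_add_tan_mul_I (by rwa [Real.cos_neg]), Real.cos_neg]
      have : Complex.exp ((2 * δ : ℝ) * Complex.I) * Complex.exp ((-δ : ℝ) * Complex.I) =
          Complex.exp (δ * Complex.I) := by
        rw [← Complex.exp_add]; congr 1; push_cast; ring
      rw [← this]; ring
    rw [e, vertex_succ]
    refine mem_segment_mul_one_add ?_ ?_
    · rw [Real.tan_neg]; linarith [htl j hj]
    · rw [Real.tan_neg]; linarith [htan (j + 1)]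

/-- A simple tangential polygon goes around its incircle once. -/
theorem sum_halfAngle_eq_pi [NeZero n] (hn : 3 ≤ n) {R : ℝ} (hpos : ∃ i, 0 < C.halfAngle i)
    (hdisj : ∀ i j : ZMod n, i ≠ j → j ≠ i + 1 → i ≠ j + 1 →
      Disjoint (_root_.segment ℝ (C.vertex R i) (C.vertex R (i + 1)))
      (_root_.segment ℝ (C.vertex R j) (C.vertex R (j + 1)))) :
    ∑ i, C.halfAngle i = Real.pi := by
  have hπ := Real.pi_pos
  obtain ⟨k, hk⟩ := C.exists_sum_halfAngle
  have hsum : 0 < ∑ i, C.halfAngle i := by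
    obtain ⟨i, hi⟩ := hpos
    exact Finset.sum_pos' (fun i _ => C.halfAngle_nonneg i) ⟨i, Finset.mem_univ i, hi⟩
  have hk0 : 0 < k := by
    rw [hk] at hsum
    exact_mod_cast pos_of_mul_pos_left hsum hπ.le
  rcases (show k = 1 ∨ 2 ≤ k by omega) with rfl | hk2
  · simpa using hk
  exfalso
  have hsum2 : 2 * Real.pi ≤ ∑ i, C.halfAngle i := by
    rw [hk]
    exact mul_le_mul_of_nonneg_right (by exact_mod_cast hk2) hπ.le
  -- Suppose the cycle winds at least twice. Start at the point `i` just before a longest jump, and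
  -- let `m` be the first index beyond a full turn. Then `m` overshoots `i` by at most the jump into
  -- `m`, which is at most the jump after `i`, so sides `i` and `m` meet.
  obtain ⟨i', -, hi'⟩ := Finset.exists_max_image Finset.univ C.halfAngle Finset.univ_nonempty
  set i : ℕ := (i' - 1).val with hi
  have hcast : ((i : ℕ) : ZMod n) + 1 = i' := by rw [hi, ZMod.natCast_zmod_val]; ring
  have hmax : ∀ l, C.halfAngle l ≤ C.halfAngle ((i : ZMod n) + 1) := fun l => by
    rw [hcast]; exact hi' l (Finset.mem_univ l)
  have hex : ∃ m, C.lift i + 2 * Real.pi < C.lift m :=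
    ⟨i + n, by rw [lift_add_card]; linarith⟩
  set m := Nat.find hex with hm
  have hm1 : C.lift i + 2 * Real.pi < C.lift m := Nat.find_spec hex
  have hg := C.halfAngle_lt ((i : ZMod n) + 1)
  have him : i + 1 < m := by
    by_contra! h
    have h1 := C.lift_mono h
    rw [lift_succ] at h1
    push_cast at h1
    linarith
  obtain ⟨j, hj⟩ : ∃ j, m = j + 1 := ⟨m - 1, by omega⟩
  have hj1 : C.lift j ≤ C.lift i + 2 * Real.pi :=
    not_lt.1 (Nat.find_min hex (by omega : j < m))
  have hmj : C.lift m = C.lift j + 2 * C.halfAngle (m : ZMod n) := by rw [hj, lift_succ]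
  -- The lift at `i + n - 1` exceeds that at `i` by more than `3 * π`, whereas `m` overshoots the
  -- full turn by less than `π`. With `i + 1 < m`, this makes the two sides nonadjacent.
  have hmn : m < i + n - 1 := by
    by_contra! h
    have h1 := C.lift_mono h
    have h2 := C.lift_add_card i
    have h3 : C.lift (i + n) = C.lift (i + n - 1) + 2 * C.halfAngle ((i + n : ℕ) : ZMod n) := by
      obtain ⟨q, hq⟩ : ∃ q, i + n = q + 1 := ⟨i + n - 1, by omega⟩
      rw [hq, lift_succ]; rfl
    have h4 := C.halfAngle_lt ((i + n : ℕ) : ZMod n)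
    have h5 := hmax (m : ZMod n)
    linarith
  obtain ⟨d, hd⟩ : ∃ d, m = i + d := ⟨m - i, by omega⟩
  have hmd : (m : ZMod n) = i + d := by rw [hd]; push_cast; rfl
  refine C.not_disjoint_sides (R := R) (i := i) (j := m)
    (δ := (C.lift m - C.lift i - 2 * Real.pi) / 2) (by linarith) ?_ ?_ (by linarith)
    (hdisj _ _ ?_ ?_ ?_)
  · rw [point_eq_exp, point_eq_exp, ← Complex.exp_add, Complex.exp_eq_exp_iff_exists_int]
    exact ⟨1, by push_cast; ring⟩
  · linarith [hmax (m : ZMod n)]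
  · intro h
    rw [hmd] at h
    exact natCast_zmod_ne_zero (n := n) (d := d) (by omega) (by omega) (by simpa using h)
  · intro h
    rw [hmd] at h
    refine natCast_zmod_ne_zero (n := n) (d := d - 1) (by omega) (by omega) ?_
    rw [Nat.cast_sub (by omega), Nat.cast_one, sub_eq_zero]
    exact add_left_cancel h
  · intro h
    rw [hmd] at h
    refine natCast_zmod_ne_zero (n := n) (d := d + 1) (by omega) (by omega) ?_
    rw [add_assoc] at h
    simpa using h

/-- The lift of the argument of the `j`-th vertex to the real line. -/
def vertexLift (j : ℕ) : ℝ := C.lift j - C.halfAngle (j : ZMod n)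

theorem vertexLift_succ (j : ℕ) :
    C.vertexLift (j + 1) = C.lift j + C.halfAngle ((j + 1 : ℕ) : ZMod n) := by
  rw [vertexLift, lift_succ]; ring

theorem vertexLift_le_succ (j : ℕ) : C.vertexLift j ≤ C.vertexLift (j + 1) := by
  rw [vertexLift_succ, vertexLift]
  linarith [C.halfAngle_nonneg (j : ZMod n), C.halfAngle_nonneg ((j + 1 : ℕ) : ZMod n)]

theorem vertexLift_card [NeZero n] (hC : ∑ i, C.halfAngle i = Real.pi) :
    C.vertexLift n = C.vertexLift 0 + 2 * Real.pi := by
  have := C.lift_add_card 0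
  rw [zero_add, hC] at this
  rw [vertexLift, vertexLift, this]
  simp
  ring

theorem vertex_eq_exp (R : ℝ) (j : ℕ) : C.vertex R (j : ZMod n) =
    ((R / Real.cos (C.halfAngle (j : ZMod n)) : ℝ) : ℂ) *
      Complex.exp (C.vertexLift j * Complex.I) := by
  have hc := (C.cos_halfAngle_pos (j : ZMod n)).ne'
  have h1 := one_add_tan_mul_I (x := - C.halfAngle (j : ZMod n)) (by rwa [Real.cos_neg])
  rw [Real.cos_neg, Real.tan_neg] at h1
  have h2 : (1 - (Real.tan (C.halfAngle (j : ZMod n)) : ℂ) * Complex.I) =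
      1 + ((-Real.tan (C.halfAngle (j : ZMod n)) : ℝ) : ℂ) * Complex.I := by push_cast; ring
  have h3 : Complex.exp (C.vertexLift j * Complex.I) = Complex.exp (C.lift j * Complex.I) *
      Complex.exp ((-C.halfAngle (j : ZMod n) : ℝ) * Complex.I) := by
    rw [← Complex.exp_add, vertexLift]; congr 1; push_cast; ring
  rw [vertex, h2, h1, point_eq_exp, h3]
  push_cast
  ring

theorem inner_exp_point (θ : ℝ) (j : ℕ) :
    inner ℝ (Complex.exp (θ * Complex.I)) (C.point (j : ZMod n)) = Real.cos (θ - C.lift j) := by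
  rw [point_eq_exp, inner_exp_exp]

theorem cos_pos_of_mem_sector {j : ℕ} {θ : ℝ} (h1 : C.vertexLift j ≤ θ)
    (h2 : θ ≤ C.vertexLift (j + 1)) : 0 < Real.cos (θ - C.lift j) := by
  rw [vertexLift_succ] at h2
  rw [vertexLift] at h1
  refine Real.cos_pos_of_mem_Ioo ⟨?_, ?_⟩
  · linarith [C.halfAngle_lt (j : ZMod n)]
  · linarith [C.halfAngle_lt ((j + 1 : ℕ) : ZMod n)]

/-- Among all points of tangency, the `j`-th is the closest to every direction in the sector of side
`j`. This uses that the cycle winds once: no other point can come back into the sector. -/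
theorem inner_exp_point_le [NeZero n] (hC : ∑ i, C.halfAngle i = Real.pi) {j : ℕ} {θ : ℝ}
    (h1 : C.vertexLift j ≤ θ) (h2 : θ ≤ C.vertexLift (j + 1)) (l : ZMod n) :
    inner ℝ (Complex.exp (θ * Complex.I)) (C.point l) ≤ Real.cos (θ - C.lift j) := by
  have hn : 0 < n := Nat.pos_of_neZero n
  rw [vertexLift_succ] at h2
  rw [vertexLift] at h1
  obtain ⟨d, hd, hl⟩ : ∃ d < n, l = ((j + d : ℕ) : ZMod n) :=
    ⟨(l - j).val, ZMod.val_lt _, by push_cast; rw [ZMod.natCast_zmod_val]; ring⟩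
  rw [hl, inner_exp_point]
  rcases Nat.eq_zero_or_pos d with rfl | hd0
  · simp
  have ha := C.lift_mono (show j + 1 ≤ j + d by omega)
  have hb := C.lift_mono (show j + d ≤ j + n - 1 by omega)
  have hc : C.lift (j + n) = C.lift (j + n - 1) + 2 * C.halfAngle ((j + n : ℕ) : ZMod n) := by
    obtain ⟨q, hq⟩ : ∃ q, j + n = q + 1 := ⟨j + n - 1, by omega⟩
    rw [hq, lift_succ]; rfl
  have he := C.lift_add_card j
  have hf : ((j + n : ℕ) : ZMod n) = j := by simp
  rw [hf] at hc
  rw [lift_succ] at ha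
  have h3 := C.halfAngle_nonneg (j : ZMod n)
  have h4 := C.halfAngle_nonneg ((j + 1 : ℕ) : ZMod n)
  -- The signs are chosen so that `lift (j + d) - θ` lies between `|θ - lift j|` and `2 * π - |θ -
  -- lift j|`.
  rw [← Real.cos_neg (θ - C.lift (j + d)), ← Real.cos_abs (θ - C.lift j)]
  refine cos_le_cos_of_dist (abs_nonneg _) (abs_le.2 ⟨?_, ?_⟩) (le_sub_comm.1 (abs_le.2 ⟨?_, ?_⟩)) <;>
    linarith

theorem exists_sector [NeZero n] (hC : ∑ i, C.halfAngle i = Real.pi) (k : ℂ) :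
    ∃ (j : ℕ) (θ : ℝ), C.vertexLift j ≤ θ ∧ θ ≤ C.vertexLift (j + 1) ∧
      k = (‖k‖ : ℂ) * Complex.exp (θ * Complex.I) := by
  set θ := toIcoMod Real.two_pi_pos (C.vertexLift 0) k.arg with hθ
  have hmem := toIcoMod_mem_Ico Real.two_pi_pos (C.vertexLift 0) k.arg
  rw [← hθ, ← C.vertexLift_card hC] at hmem
  have hex : ∃ m, θ < C.vertexLift m := ⟨n, hmem.2⟩
  obtain ⟨j, hj⟩ : ∃ j, Nat.find hex = j + 1 := by
    refine Nat.exists_eq_succ_of_ne_zero fun h0 => ?_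
    have := Nat.find_spec hex
    rw [h0] at this
    linarith [hmem.1]
  refine ⟨j, θ, not_lt.1 (Nat.find_min hex (by omega)), ?_, ?_⟩
  · rw [← hj]; exact (Nat.find_spec hex).le
  · have e : Complex.exp (θ * Complex.I) = Complex.exp (k.arg * Complex.I) := by
      rw [Complex.exp_eq_exp_iff_exists_int]
      refine ⟨-toIcoDiv Real.two_pi_pos (C.vertexLift 0) k.arg, ?_⟩
      have := toIcoMod_add_toIcoDiv_zsmul Real.two_pi_pos (C.vertexLift 0) k.arg
      rw [← hθ] at this
      have h2 := congrArg (fun x : ℝ => (x : ℂ)) this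
      simp only [zsmul_eq_mul] at h2
      push_cast at h2 ⊢
      rw [← h2]
      ring
    rw [e, Complex.norm_mul_exp_arg_mul_I]

end TangentCycle

end

/-! ### The polygon cut out by the tangents, and its area -/

section

/-- The area of the right triangles between a tangent and the centre, as an antiderivative. -/
theorem hasDerivAt_arcsin_cosh_mul_sin {r x : ℝ}
    (hx : Real.tanh r < Real.cos x) (hr : 0 < r) :
    HasDerivAt (fun x => Real.arcsin (Real.cosh r * Real.sin x) - x)
      ((√(1 - (Real.tanh r / Real.cos x) ^ 2))⁻¹ - 1) x := by
  have hK := Real.cosh_pos r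
  have ht : 0 < Real.tanh r := by
    rw [Real.tanh_eq_sinh_div_cosh]; exact div_pos (Real.sinh_pos_iff.2 hr) hK
  have hc : 0 < Real.cos x := ht.trans hx
  have hK2 : Real.cosh r ^ 2 * (1 - Real.tanh r ^ 2) = 1 := by
    rw [Real.tanh_eq_sinh_div_cosh]
    have := Real.cosh_sq r
    field_simp
    linarith
  have hlt : Real.tanh r ^ 2 < Real.cos x ^ 2 := by gcongr
  have hs2 := Real.sin_sq_add_cos_sq x
  have hlt1 : (Real.cosh r * Real.sin x) ^ 2 < 1 := by
    rw [mul_pow]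
    have : 0 < Real.cosh r ^ 2 := by positivity
    nlinarith
  have habs := abs_lt.1 (sq_lt_one_iff_abs_lt_one _ |>.1 hlt1)
  have h1 := (Real.hasDerivAt_arcsin habs.1.ne' habs.2.ne).comp x
    ((Real.hasDerivAt_sin x).const_mul (Real.cosh r))
  refine (h1.sub (hasDerivAt_id x)).congr_deriv ?_
  have e : √(1 - (Real.cosh r * Real.sin x) ^ 2) =
      Real.cosh r * Real.cos x * √(1 - (Real.tanh r / Real.cos x) ^ 2) := by
    have hpos : 0 ≤ Real.cosh r * Real.cos x := by positivity
    rw [← Real.sqrt_sq hpos, ← Real.sqrt_mul (sq_nonneg _)]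
    congr 1
    field_simp
    linear_combination (-Real.cosh r ^ 2) * hs2 - hK2
  have hpos : 0 < 1 - (Real.tanh r / Real.cos x) ^ 2 := by
    rw [div_pow, sub_pos, div_lt_one (by positivity)]; exact hlt
  have := Real.sqrt_pos.2 hpos
  rw [e]
  field_simp

namespace TangentCycle

variable {n : ℕ} [NeZero n] (C : TangentCycle n)

/-- The support function of the cycle: the polygon that is bounded by the tangents of the circle
of radius `R` is the set where it is at most `R`. -/
def support (k : ℂ) : ℝ :=
  Finset.univ.sup' Finset.univ_nonempty fun i => inner ℝ k (C.point i)

theorem inner_le_support (k : ℂ) (i : ZMod n) : inner ℝ k (C.point i) ≤ C.support k :=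
  Finset.le_sup' (fun i => inner ℝ k (C.point i)) (Finset.mem_univ i)

theorem support_le {k : ℂ} {a : ℝ} (h : ∀ i, inner ℝ k (C.point i) ≤ a) : C.support k ≤ a :=
  Finset.sup'_le _ _ fun i _ => h i

theorem continuous_support : Continuous C.support := by
  unfold support
  exact Continuous.finset_sup'_apply _ fun i _ => by fun_prop

theorem support_zero : C.support 0 = 0 := by
  simp [support]

theorem support_smul {s : ℝ} (hs : 0 ≤ s) (k : ℂ) : C.support (s * k) = s * C.support k := by
  have h : ∀ i, inner ℝ ((s : ℂ) * k) (C.point i) = s * inner ℝ k (C.point i) := fun i => by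
    rw [← Complex.real_smul, real_inner_smul_left]
  refine le_antisymm (C.support_le fun i => ?_) ?_
  · rw [h]; exact mul_le_mul_of_nonneg_left (C.inner_le_support k i) hs
  · obtain ⟨i, -, hi⟩ := Finset.exists_mem_eq_sup' Finset.univ_nonempty
      fun i => inner ℝ k (C.point i)
    rw [support, hi, ← h]
    exact C.inner_le_support _ i

variable {C}

theorem support_exp (hC : ∑ i, C.halfAngle i = Real.pi) {j : ℕ} {θ : ℝ} (h1 : C.vertexLift j ≤ θ)
    (h2 : θ ≤ C.vertexLift (j + 1)) :
    C.support (Complex.exp (θ * Complex.I)) = Real.cos (θ - C.lift j) := by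
  refine le_antisymm (C.support_le fun i => C.inner_exp_point_le hC h1 h2 i) ?_
  rw [← C.inner_exp_point]
  exact C.inner_le_support _ _

theorem support_pos (hC : ∑ i, C.halfAngle i = Real.pi) {k : ℂ} (hk : k ≠ 0) : 0 < C.support k := by
  obtain ⟨j, θ, h1, h2, h3⟩ := C.exists_sector hC k
  rw [h3, C.support_smul (norm_nonneg k), support_exp hC h1 h2]
  exact mul_pos (norm_pos_iff.2 hk) (C.cos_pos_of_mem_sector h1 h2)

/-- Vertices `i` and `i + 1` satisfy every tangent inequality and lie on the tangent `i`, hence so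
does the side between them. Conversely, a point of the level set in sector `j` lies on the tangent
`j`, and the bounds of the sector place it between the vertices. -/
theorem exists_mem_side_iff (hC : ∑ i, C.halfAngle i = Real.pi) {R : ℝ} (hR : 0 < R) (k : ℂ) :
    (∃ i, k ∈ _root_.segment ℝ (C.vertex R i) (C.vertex R (i + 1))) ↔ C.support k = R := by
  constructor
  · rintro ⟨i, hi⟩
    have hv : ∀ i l, inner ℝ (C.vertex R i) (C.point l) ≤ R := by
      intro i l
      rw [← ZMod.natCast_zmod_val i, vertex_eq_exp, ← Complex.real_smul, real_inner_smul_left]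
      have hc := C.cos_halfAngle_pos (i.val : ZMod n)
      have h := C.inner_exp_point_le hC le_rfl (C.vertexLift_le_succ i.val) l
      have e : C.vertexLift i.val - C.lift i.val = - C.halfAngle (i.val : ZMod n) := by
        rw [vertexLift]; ring
      rw [e, Real.cos_neg] at h
      calc _ ≤ R / Real.cos (C.halfAngle (i.val : ZMod n)) *
            Real.cos (C.halfAngle (i.val : ZMod n)) := mul_le_mul_of_nonneg_left h (by positivity)
        _ = R := div_mul_cancel₀ _ hc.ne'
    have hu : inner ℝ (C.point i) (C.point i) = (1 : ℝ) := by
      rw [real_inner_self_eq_norm_sq, C.norm_point]; norm_num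
    have hu' := hu
    rw [inner_eq_re_add_im] at hu'
    have hv1 : inner ℝ (C.vertex R i) (C.point i) = R := by
      rw [inner_eq_re_add_im]
      simp [vertex]
      linear_combination R * hu'
    have hv2 : inner ℝ (C.vertex R (i + 1)) (C.point i) = R := by
      rw [vertex_succ, inner_eq_re_add_im]
      simp
      linear_combination R * hu'
    obtain ⟨s, t, hs, ht, hst, rfl⟩ := hi
    refine le_antisymm (C.support_le fun l => ?_) ?_
    · rw [inner_add_left, real_inner_smul_left, real_inner_smul_left]
      have h1 := mul_le_mul_of_nonneg_left (hv i l) hs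
      have h2 := mul_le_mul_of_nonneg_left (hv (i + 1) l) ht
      have h3 : s * R + t * R = R := by rw [← add_mul, hst, one_mul]
      linarith
    · refine le_trans (le_of_eq ?_) (C.inner_le_support _ i)
      rw [inner_add_left, real_inner_smul_left, real_inner_smul_left, hv1, hv2, ← add_mul, hst,
        one_mul]
  · intro hk
    obtain ⟨j, θ, h1, h2, h3⟩ := C.exists_sector hC k
    have hc := C.cos_pos_of_mem_sector h1 h2
    rw [h3, C.support_smul (norm_nonneg k), support_exp hC h1 h2] at hk
    refine ⟨j, ?_⟩
    have hk2 : k = R * C.point j * (1 + Real.tan (θ - C.lift j) * Complex.I) := by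
      rw [one_add_tan_mul_I hc.ne', point_eq_exp, ← hk]
      have : Complex.exp (θ * Complex.I) = Complex.exp (C.lift j * Complex.I) *
          Complex.exp ((θ - C.lift j : ℝ) * Complex.I) := by
        rw [← Complex.exp_add]; congr 1; push_cast; ring
      rw [this] at h3
      have hc' : (Real.cos (θ - C.lift j) : ℂ) ≠ 0 := by exact_mod_cast hc.ne'
      rw [Complex.ofReal_mul]
      field_simp
      rw [mul_assoc, mul_comm Complex.I]
      exact h3
    rw [hk2, vertex_succ]
    have hpi := Real.pi_pos
    have hj := C.halfAngle_lt (j : ZMod n)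
    have hj1 := C.halfAngle_lt ((j : ZMod n) + 1)
    have hj0 := C.halfAngle_nonneg (j : ZMod n)
    have hj10 := C.halfAngle_nonneg ((j : ZMod n) + 1)
    rw [vertexLift_succ] at h2
    rw [vertexLift] at h1
    push_cast at h2
    refine mem_segment_mul_one_add ?_ ?_
    · rw [← Real.tan_neg]
      exact Real.strictMonoOn_tan.monotoneOn ⟨by linarith, by linarith⟩
        ⟨by linarith, by linarith⟩ (by linarith)
    · exact Real.strictMonoOn_tan.monotoneOn ⟨by linarith, by linarith⟩
        ⟨by linarith, by linarith⟩ (by linarith)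

/-- The points farthest from the origin are vertices, at distance `R / cos (α i) < 1`. So the
polygon stays away from the ideal boundary. -/
theorem exists_norm_le (hC : ∑ i, C.halfAngle i = Real.pi) {R : ℝ}
    (hRC : ∀ i, R < Real.cos (C.halfAngle i)) :
    ∃ m < 1, ∀ k, C.support k ≤ R → ‖k‖ ≤ m := by
  obtain ⟨i, -, hi⟩ := Finset.exists_min_image Finset.univ
    (fun i => Real.cos (C.halfAngle i)) Finset.univ_nonempty
  have hci := C.cos_halfAngle_pos i
  refine ⟨R / Real.cos (C.halfAngle i), (div_lt_one hci).2 (hRC i), fun k hk => ?_⟩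
  obtain ⟨j, θ, h1, h2, h3⟩ := C.exists_sector hC k
  rw [h3, C.support_smul (norm_nonneg k), support_exp hC h1 h2] at hk
  have hc : Real.cos (C.halfAngle i) ≤ Real.cos (θ - C.lift j) := by
    have hpi := Real.pi_pos
    have hj := C.halfAngle_lt (j : ZMod n)
    have hj1 := C.halfAngle_lt ((j + 1 : ℕ) : ZMod n)
    rw [vertexLift_succ] at h2
    rw [vertexLift] at h1
    rcases le_total 0 (θ - C.lift j) with h | h
    · exact (hi ((j + 1 : ℕ) : ZMod n) (Finset.mem_univ _)).trans
        (Real.cos_le_cos_of_nonneg_of_le_pi h (by linarith) (by linarith))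
    · rw [← Real.cos_neg (θ - C.lift j)]
      exact (hi (j : ZMod n) (Finset.mem_univ _)).trans
        (Real.cos_le_cos_of_nonneg_of_le_pi (by linarith) (by linarith) (by linarith))
  rw [le_div_iff₀ hci]
  exact (mul_le_mul_of_nonneg_left hc (norm_nonneg k)).trans hk

/-- The hyperbolic area of the polygon that is cut out by the tangents. -/
theorem lintegral_kleinDensity_support_le (hC : ∑ i, C.halfAngle i = Real.pi) {r : ℝ} (hr : 0 < r)
    (hrC : ∀ i, Real.tanh r < Real.cos (C.halfAngle i)) :
    ∫⁻ v in {v : ℝ × ℝ | C.support (Complex.measurableEquivRealProd.symm v) ≤ Real.tanh r},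
      ENNReal.ofReal (kleinDensity v) = ENNReal.ofReal
        (2 * ∑ i, Real.arcsin (Real.cosh r * Real.sin (C.halfAngle i)) - 2 * Real.pi) := by
  have hK := Real.cosh_pos r
  have hR : 0 < Real.tanh r := by
    rw [Real.tanh_eq_sinh_div_cosh]; exact div_pos (Real.sinh_pos_iff.2 hr) hK
  obtain ⟨m, hm1, hm⟩ := exists_norm_le hC hrC
  set H : ℝ → ℝ := fun θ => C.support (Complex.exp (θ * Complex.I)) with hH
  have hHc : Continuous H := C.continuous_support.comp (by fun_prop)
  have hHpos : ∀ θ, 0 < H θ := fun θ => support_pos hC (Complex.exp_ne_zero _)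
  have hHR : ∀ θ, Real.tanh r < H θ := by
    intro θ
    by_contra! h
    have := hm _ h
    rw [Complex.norm_exp_ofReal_mul_I] at this
    linarith
  have hρc : Continuous fun θ => Real.tanh r / H θ :=
    continuous_const.div hHc fun θ => (hHpos θ).ne'
  have hmeas : MeasurableSet
      {v : ℝ × ℝ | C.support (Complex.measurableEquivRealProd.symm v) ≤ Real.tanh r} :=
    measurableSet_le (C.continuous_support.measurable.comp
      Complex.measurableEquivRealProd.symm.measurable) measurable_const
  rw [lintegral_kleinDensity_of_starShaped hρc (fun θ => div_pos hR (hHpos θ))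
    (fun θ => (div_lt_one (hHpos θ)).2 (hHR θ)) hmeas]
  · congr 1
    set G : ℝ → ℝ := fun θ => (√(1 - (Real.tanh r / H θ) ^ 2))⁻¹ - 1 with hG
    have hGper : Function.Periodic G (2 * Real.pi) := by
      intro θ
      have : H (θ + 2 * Real.pi) = H θ := by
        simp only [hH]
        congr 1
        rw [Complex.exp_eq_exp_iff_exists_int]
        exact ⟨1, by push_cast; ring⟩
      simp only [hG, this]
    have hGc : Continuous G := by
      refine (Continuous.inv₀ (by fun_prop) fun θ => ?_).sub continuous_const
      have h1 : Real.tanh r / H θ < 1 := (div_lt_one (hHpos θ)).2 (hHR θ)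
      have h2 : 0 < Real.tanh r / H θ := div_pos hR (hHpos θ)
      exact (Real.sqrt_pos.2 (by nlinarith)).ne'
    -- Periodicity moves the start of the integral to a vertex, so that it splits into whole
    -- sectors.
    have e1 : ∫ θ in (-Real.pi)..Real.pi, G θ =
        ∫ θ in (C.vertexLift 0)..(C.vertexLift n), G θ := by
      have := hGper.intervalIntegral_add_eq (-Real.pi) (C.vertexLift 0)
      rw [vertexLift_card C hC, ← this]
      congr 1
      ring
    rw [e1, ← intervalIntegral.sum_integral_adjacent_intervals
      fun j _ => hGc.intervalIntegrable _ _]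
    -- On sector `j` the variable `θ - lift j` runs from `-α j` to `α (j + 1)`, and the
    -- antiderivative is odd.
    have e2 : ∀ j : ℕ, ∫ θ in (C.vertexLift j)..(C.vertexLift (j + 1)), G θ =
        (Real.arcsin (Real.cosh r * Real.sin (C.halfAngle ((j : ZMod n) + 1))) -
          C.halfAngle ((j : ZMod n) + 1)) +
        (Real.arcsin (Real.cosh r * Real.sin (C.halfAngle (j : ZMod n))) -
          C.halfAngle (j : ZMod n)) := by
      intro j
      have hle := C.vertexLift_le_succ j
      rw [intervalIntegral.integral_eq_sub_of_hasDerivAt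
        (f := fun θ => Real.arcsin (Real.cosh r * Real.sin (θ - C.lift j)) - (θ - C.lift j))
        (fun θ hθ => ?_) (hGc.intervalIntegrable _ _)]
      · rw [vertexLift_succ, vertexLift]
        have a1 : C.lift j - C.halfAngle (j : ZMod n) - C.lift j = -C.halfAngle (j : ZMod n) := by
          ring
        have a2 : C.lift j + C.halfAngle ((j + 1 : ℕ) : ZMod n) - C.lift j =
          C.halfAngle ((j : ZMod n) + 1) := by push_cast; ring
        rw [a1, a2, Real.sin_neg, mul_neg, Real.arcsin_neg]
        ring
      · rw [Set.uIcc_of_le hle] at hθ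
        have hs := support_exp hC hθ.1 hθ.2
        have hlt : Real.tanh r < Real.cos (θ - C.lift j) := by
          rw [← hs]; exact hHR θ
        have := (hasDerivAt_arcsin_cosh_mul_sin hlt hr).comp_sub_const θ (C.lift j)
        simp only [hG, hH, hs]
        exact this
    simp only [e2]
    -- Each half angle occurs in the two sectors next to its vertex, hence the factor `2`.
    rw [Finset.sum_add_distrib, sum_range_natCast_zmod (fun i : ZMod n =>
      Real.arcsin (Real.cosh r * Real.sin (C.halfAngle (i + 1))) - C.halfAngle (i + 1)),
      sum_range_natCast_zmod (fun i : ZMod n =>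
      Real.arcsin (Real.cosh r * Real.sin (C.halfAngle i)) - C.halfAngle i),
      Fintype.sum_equiv (Equiv.addRight (1 : ZMod n)) (fun i : ZMod n =>
      Real.arcsin (Real.cosh r * Real.sin (C.halfAngle (i + 1))) - C.halfAngle (i + 1))
      (fun i : ZMod n =>
      Real.arcsin (Real.cosh r * Real.sin (C.halfAngle i)) - C.halfAngle i) (fun i => rfl),
      Finset.sum_sub_distrib, hC]
    ring
  · intro s θ hs
    rw [le_div_iff₀ (hHpos θ)]
    have : Complex.measurableEquivRealProd.symm (s * Real.cos θ, s * Real.sin θ) =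
        s * Complex.exp (θ * Complex.I) := by
      rw [MeasurableEquiv.symm_apply_eq]
      ext <;> simp [Complex.measurableEquivRealProd_apply, Complex.exp_ofReal_mul_I_re,
        Complex.exp_ofReal_mul_I_im]
    rw [Set.mem_ofPred_eq, this, C.support_smul hs.le]

end TangentCycle

end

/-! ### From an incircle to a tangent cycle -/

section

variable {c : ℍ} {σ : ℝ}

theorem mem_line_of_klein_eq (hσ : σ ^ 2 = 1) {a b x : ℍ} {s : ℝ}
    (h : klein c σ x = klein c σ a + s • (klein c σ b - klein c σ a)) : x ∈ line a b := by
  rcases le_or_gt 0 s with h0 | h0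
  · rcases le_or_gt s 1 with h1 | h1
    · refine Or.inl ((mem_segment_iff (c := c) hσ).2 ?_)
      rw [segment_eq_image']
      exact ⟨s, ⟨h0, h1⟩, h.symm⟩
    · refine Or.inr (Or.inl ((mem_segment_iff (c := c) hσ).2 ?_))
      rw [segment_eq_image']
      refine ⟨s⁻¹, ⟨by positivity, inv_le_one_of_one_le₀ h1.le⟩, ?_⟩
      simp only [h, add_sub_cancel_left, smul_smul]
      rw [inv_mul_cancel₀ (by positivity), one_smul, add_sub_cancel]
  · refine Or.inr (Or.inr ((mem_segment_iff (c := c) hσ).2 ?_))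
    rw [segment_symm, segment_eq_image']
    have h2 : 0 < 1 - s := by linarith
    refine ⟨(1 - s)⁻¹, ⟨by positivity, inv_le_one_of_one_le₀ (by linarith)⟩, ?_⟩
    have e : klein c σ x - klein c σ b = (1 - s) • (klein c σ a - klein c σ b) := by
      rw [h]; module
    simp only [e, smul_smul]
    rw [inv_mul_cancel₀ h2.ne', one_smul, add_sub_cancel]

theorem tanh_pos_of_pos {r : ℝ} (hr : 0 < r) : 0 < Real.tanh r := by
  rw [Real.tanh_eq_sinh_div_cosh]
  exact div_pos (Real.sinh_pos_iff.2 hr) (Real.cosh_pos r)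

theorem cosh_sq_mul_one_sub_tanh_sq (r : ℝ) : Real.cosh r ^ 2 * (1 - Real.tanh r ^ 2) = 1 := by
  have h := Real.cosh_pos r
  have := Real.cosh_sq r
  rw [Real.tanh_eq_sinh_div_cosh]
  field_simp
  linarith

theorem mem_sphere_iff_norm_klein (hσ : σ ^ 2 = 1) {r : ℝ} (hr : 0 < r) {z : ℍ} :
    z ∈ Metric.sphere c r ↔ ‖klein c σ z‖ = Real.tanh r := by
  have h1 := lorentz_sq_mul (c := c) hσ z
  have h2 := lorentz_pos c z
  have h3 := cosh_sq_mul_one_sub_tanh_sq r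
  have h4 := Real.cosh_pos r
  have h5 := tanh_pos_of_pos hr
  rw [Metric.mem_sphere]
  constructor
  · intro h
    rw [← cosh_dist_center, h] at h1
    have : ‖klein c σ z‖ ^ 2 = Real.tanh r ^ 2 := by
      have := mul_left_cancel₀ (pow_ne_zero 2 h4.ne') (h1.trans h3.symm)
      linarith
    exact (pow_left_inj₀ (norm_nonneg _) h5.le two_ne_zero).1 this
  · intro h
    rw [h] at h1
    have h6 : (1 - Real.tanh r ^ 2) ≠ 0 := by
      intro h0; rw [h0, mul_zero] at h3; exact zero_ne_one h3
    have h7 := mul_right_cancel₀ h6 (h1.trans h3.symm)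
    have h8 := (pow_left_inj₀ h2.le h4.le two_ne_zero).1 h7
    rw [← cosh_dist_center] at h8
    exact Real.cosh_injOn dist_nonneg hr.le h8

/-- In the Klein disc the point of tangency is the foot of the perpendicular from the origin. Here
`x` and `y` are signed distances along the tangent in units of `tanh r`; they do not have opposite
signs because `t` lies between `a` and `b`. -/
theorem exists_tangent_point {a b : ℍ} (hab : a ≠ b) {r : ℝ} (hr : 0 < r) {t : ℍ}
    (ht : t ∈ segment a b) (hline : line a b ∩ Metric.sphere c r = {t}) :
    ∃ (u : ℂ) (x y : ℝ), ‖u‖ = 1 ∧ 0 ≤ x * y ∧ x + y ≠ 0 ∧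
      klein c 1 a = Real.tanh r * u * (1 - x * Complex.I) ∧
      klein c 1 b = Real.tanh r * u * (1 + y * Complex.I) := by
  have hσ : (1 : ℝ) ^ 2 = 1 := one_pow 2
  have hR := tanh_pos_of_pos hr
  have hts : t ∈ Metric.sphere c r := (hline.symm ▸ rfl : t ∈ line a b ∩ Metric.sphere c r).2
  have hn := (mem_sphere_iff_norm_klein hσ hr).1 hts
  rw [mem_segment_iff (c := c) hσ, segment_eq_image'] at ht
  obtain ⟨s, ⟨hs0, hs1⟩, hs⟩ := ht
  set τ := klein c 1 t with hτ
  set d := klein c 1 b - klein c 1 a with hd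
  have hd0 : d ≠ 0 := sub_ne_zero.2 fun h => hab (klein_injective hσ h).symm
  have hdd : 0 < inner ℝ d d := by rw [real_inner_self_eq_norm_sq]; positivity
  have horth : inner ℝ τ d = 0 := by
    -- `τ + s' • d` is the other intersection of the line with the circle. Uniqueness forces `s' =
    -- 0`, which is orthogonality.
    set s' := -2 * inner ℝ τ d / inner ℝ d d with hs'
    have hτ' : ‖τ + s' • d‖ = Real.tanh r := by
      rw [← hn]
      refine (pow_left_inj₀ (norm_nonneg _) (norm_nonneg _) two_ne_zero).1 ?_
      rw [← real_inner_self_eq_norm_sq, ← real_inner_self_eq_norm_sq]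
      simp only [inner_add_left, inner_add_right, real_inner_smul_left, real_inner_smul_right]
      rw [real_inner_comm τ d, hs']
      field_simp
      ring
    obtain ⟨z, hz⟩ := exists_klein_eq (c := c) hσ (k := τ + s' • d)
      (by rw [hτ']; exact Real.tanh_lt_one r)
    have hzl : z ∈ line a b := by
      refine mem_line_of_klein_eq (c := c) hσ (s := s + s') ?_
      rw [hz, ← hs]
      module
    have hzt : z ∈ ({t} : Set ℍ) :=
      hline ▸ ⟨hzl, (mem_sphere_iff_norm_klein hσ hr).2 (hz ▸ hτ')⟩
    rw [Set.mem_singleton_iff.1 hzt, ← hτ, left_eq_add, smul_eq_zero_iff_left hd0, hs',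
      div_eq_zero_iff] at hz
    rcases hz with h | h
    · linarith
    · exact absurd h hdd.ne'
  have hRc : (Real.tanh r : ℂ) ≠ 0 := by exact_mod_cast hR.ne'
  have hnn : τ.re ^ 2 + τ.im ^ 2 = Real.tanh r ^ 2 := by rw [← norm_sq_eq_re_add_im, hn]
  rw [inner_eq_re_add_im] at horth
  obtain ⟨l, hl⟩ : ∃ l : ℝ, d = l * (τ * Complex.I) := by
    refine ⟨(τ.re * d.im - τ.im * d.re) / Real.tanh r ^ 2, ?_⟩
    have : Real.tanh r ≠ 0 := hR.ne'
    apply Complex.ext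
    · rw [Complex.re_ofReal_mul, Complex.mul_I_re]
      field_simp
      rw [← hnn]
      linear_combination τ.re * horth
    · rw [Complex.im_ofReal_mul, Complex.mul_I_im]
      field_simp
      rw [← hnn]
      linear_combination τ.im * horth
  have hl0 : l ≠ 0 := by
    rintro rfl
    exact hd0 (by rw [hl]; simp)
  refine ⟨τ / Real.tanh r, s * l, (1 - s) * l, ?_, ?_, ?_, ?_, ?_⟩
  · rw [norm_div, hn, Complex.norm_real, Real.norm_of_nonneg hR.le, div_self hR.ne']
  · have : s * l * ((1 - s) * l) = s * (1 - s) * l ^ 2 := by ring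
    rw [this]
    have : 0 ≤ 1 - s := by linarith
    positivity
  · rw [← add_mul]; simpa using hl0
  · rw [mul_div_cancel₀ _ hRc]
    have : klein c 1 a = τ - s • d := by rw [← hs]; module
    rw [this, hl, Complex.real_smul]
    push_cast; ring
  · rw [mul_div_cancel₀ _ hRc]
    have : klein c 1 b = τ + (1 - s) • d := by rw [← hs, hd]; module
    rw [this, hl, Complex.real_smul]
    push_cast; ring

/-- For the signed tangent lengths `a i` this says that the polygon always turns the same way. The
sign passes along each side by `h1`; `h3` carries it across a vertex that is itself a point of
tangency. -/
theorem all_nonneg_or_all_nonpos {n : ℕ} [NeZero n] (a : ZMod n → ℝ)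
    (h1 : ∀ i, 0 ≤ a i * a (i + 1)) (h2 : ∀ i, a i + a (i + 1) ≠ 0)
    (h3 : ∀ i, a (i + 1) = 0 → 0 ≤ a i * a (i + 1 + 1)) :
    (∀ i, 0 ≤ a i) ∨ ∀ i, a i ≤ 0 := by
  have key : ∀ a : ZMod n → ℝ, (∀ i, 0 ≤ a i * a (i + 1)) → (∀ i, a i + a (i + 1) ≠ 0) →
      (∀ i, a (i + 1) = 0 → 0 ≤ a i * a (i + 1 + 1)) → 0 ≤ a 0 → 0 ≤ a 1 → ∀ i, 0 ≤ a i := by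
    intro a h1 h2 h3 h0 h01 i
    have : ∀ j : ℕ, 0 ≤ a (j : ZMod n) ∧ 0 ≤ a ((j : ZMod n) + 1) := by
      intro j
      induction j with
      | zero => simpa using ⟨h0, h01⟩
      | succ j ih =>
        push_cast
        refine ⟨ih.2, ?_⟩
        rcases ih.2.eq_or_lt with h | h
        · have h4 : 0 < a (j : ZMod n) := by
            refine lt_of_le_of_ne ih.1 fun h5 => h2 j ?_
            rw [← h, ← h5, add_zero]
          exact nonneg_of_mul_nonneg_right (h3 j h.symm) h4
        · exact nonneg_of_mul_nonneg_right (h1 ((j : ZMod n) + 1)) h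
    rw [← ZMod.natCast_zmod_val i]
    exact (this i.val).1
  have h := h1 0
  rw [zero_add] at h
  rcases nonneg_and_nonneg_or_nonpos_and_nonpos_of_mul_nonneg h with ⟨h4, h5⟩ | ⟨h4, h5⟩
  · exact Or.inl (key a h1 h2 h3 h4 h5)
  · refine Or.inr fun i => ?_
    have := key (fun i => -a i) (fun i => by simpa using h1 i)
      (fun i h => h2 i (by linarith)) (fun i h => by simpa using h3 i (by simpa using h))
      (by simpa using h4) (by simpa using h5) i
    simpa using this

/-- The cycle with given tangents of the half angles. -/
theorem exists_tangentCycle_of_tan {n : ℕ} {R : ℝ} (hR : R ≠ 0) {v u : ZMod n → ℂ}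
    {a : ZMod n → ℝ} (ha : ∀ i, 0 ≤ a i) (hu : ∀ i, ‖u i‖ = 1)
    (h1 : ∀ i, v i = R * u i * (1 - a i * Complex.I))
    (h2 : ∀ i, v (i + 1) = R * u i * (1 + a (i + 1) * Complex.I)) :
    ∃ C : TangentCycle n, (∀ i, v i = C.vertex R i) ∧
      ∀ i, C.halfAngle i = Real.arctan (a i) := by
  refine ⟨⟨u, fun i => Real.arctan (a i), hu, fun i => Real.arctan_nonneg.2 (ha i),
    fun i => Real.arctan_lt_pi_div_two _, fun i => ?_⟩, fun i => ?_, fun i => rfl⟩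
  · have hc := Real.cos_arctan_pos (a (i + 1))
    have e1 := one_add_tan_mul_I hc.ne'
    have e2 := one_add_tan_mul_I (x := -Real.arctan (a (i + 1))) (by
      rw [Real.cos_neg]; exact hc.ne')
    rw [Real.tan_neg, Real.cos_neg] at e2
    rw [Real.tan_arctan] at e1 e2
    have h3 := (h2 i).symm.trans (h1 (i + 1))
    have hR' : (R : ℂ) ≠ 0 := by exact_mod_cast hR
    rw [mul_assoc, mul_assoc] at h3
    have h4 := mul_left_cancel₀ hR' h3
    have e3 : (1 - (a (i + 1) : ℂ) * Complex.I) = 1 + ((-a (i + 1) : ℝ) : ℂ) * Complex.I := by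
      push_cast; ring
    have hc' : (Real.cos (Real.arctan (a (i + 1))) : ℂ) ≠ 0 := by exact_mod_cast hc.ne'
    rw [e1, e3, e2, mul_div_assoc', mul_div_assoc', div_left_inj' hc'] at h4
    have e5 : Complex.exp ((2 * Real.arctan (a (i + 1)) : ℝ) * Complex.I) =
        Complex.exp (Real.arctan (a (i + 1)) * Complex.I) *
        Complex.exp (Real.arctan (a (i + 1)) * Complex.I) := by
      rw [← Complex.exp_add]; congr 1; push_cast; ring
    have e4 : Complex.exp ((-Real.arctan (a (i + 1)) : ℝ) * Complex.I) *
        Complex.exp (Real.arctan (a (i + 1)) * Complex.I) = 1 := by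
      rw [← Complex.exp_add]; simp
    change u (i + 1) = u i * Complex.exp ((2 * Real.arctan (a (i + 1)) : ℝ) * Complex.I)
    rw [e5, ← mul_assoc, h4, mul_assoc, e4, mul_one]
  · simp only [TangentCycle.vertex, Real.tan_arctan]
    exact h1 i

theorem klein_neg_one (z : ℍ) : klein c (-1) z = (starRingEnd ℂ) (klein c 1 z) := by
  apply Complex.ext
  · simp [klein]
  · simp [klein]; ring

namespace Polygon

variable {n : ℕ} {P : Polygon n} {r : ℝ}

theorem vertex_ne_succ (i : ZMod n) : P.vertex i ≠ P.vertex (i + 1) := by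
  intro h
  have h1 := P.vertex_injective h
  have := P.three_le
  exact natCast_zmod_ne_zero (n := n) (d := 1) one_pos (by omega) (by simpa using h1)

/-- Both tangents from a vertex to the circle have the same length. Simplicity at the vertices
excludes a change of sign, and a polygon that turns clockwise is reflected by taking `σ = -1`. -/
theorem IsIncircle.exists_cycle (hP : P.IsIncircle c r) :
    ∃ (σ : ℝ) (C : TangentCycle n), σ ^ 2 = 1 ∧
      (∀ i, klein c σ (P.vertex i) = C.vertex (Real.tanh r) i) ∧ ∃ i, 0 < C.halfAngle i := by
  have h3n := P.three_le
  have : NeZero n := ⟨by omega⟩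
  obtain ⟨hr, hP⟩ := hP
  have hR := tanh_pos_of_pos hr
  have hσ : (1 : ℝ) ^ 2 = 1 := one_pow 2
  have hRc : (Real.tanh r : ℂ) ≠ 0 := by exact_mod_cast hR.ne'
  have hex : ∀ i, ∃ (u : ℂ) (x y : ℝ), ‖u‖ = 1 ∧ 0 ≤ x * y ∧ x + y ≠ 0 ∧
      klein c 1 (P.vertex i) = Real.tanh r * u * (1 - x * Complex.I) ∧
      klein c 1 (P.vertex (i + 1)) = Real.tanh r * u * (1 + y * Complex.I) := fun i => by
    obtain ⟨t, ht, hl⟩ := hP i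
    exact exists_tangent_point (vertex_ne_succ i) hr ht hl
  choose u a b hu hab hab0 ha hb using hex
  have hadj : ∀ i k, k ∈ _root_.segment ℝ (klein c 1 (P.vertex i)) (klein c 1 (P.vertex (i + 1))) →
      k ∈ _root_.segment ℝ (klein c 1 (P.vertex (i + 1))) (klein c 1 (P.vertex (i + 1 + 1))) →
      k = klein c 1 (P.vertex (i + 1)) := by
    intro i k h1 h2
    have hk : ‖k‖ < 1 := by
      have := (convex_ball (0 : ℂ) 1).segment_subset
        (by simpa using norm_klein_lt_one (c := c) hσ (P.vertex i))
        (by simpa using norm_klein_lt_one (c := c) hσ (P.vertex (i + 1))) h1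
      simpa using this
    obtain ⟨z, rfl⟩ := exists_klein_eq (c := c) hσ hk
    rw [← mem_segment_iff hσ] at h1 h2
    have : z ∈ ({P.vertex (i + 1)} : Set ℍ) := P.adjacent_sides i ▸ ⟨h1, h2⟩
    rw [Set.mem_singleton_iff.1 this]
  have hmid : ∀ i, (Real.tanh r : ℂ) * u i ∈
      _root_.segment ℝ (klein c 1 (P.vertex i)) (klein c 1 (P.vertex (i + 1))) := by
    intro i
    rw [ha, hb]
    have hs := hab0 i
    have hs2 : 0 < (a i + b i) ^ 2 := by positivity
    -- These are the weights `b / (a + b)` and `a / (a + b)`, expanded by `a + b` so that `0 ≤ a *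
    -- b` shows their sign in both cases.
    refine ⟨b i * (a i + b i) / (a i + b i) ^ 2, a i * (a i + b i) / (a i + b i) ^ 2, ?_, ?_, ?_, ?_⟩
    · refine div_nonneg ?_ hs2.le
      nlinarith [hab i, sq_nonneg (b i)]
    · refine div_nonneg ?_ hs2.le
      nlinarith [hab i, sq_nonneg (a i)]
    · field_simp; ring
    · have hc : (a i + b i : ℂ) ≠ 0 := by exact_mod_cast hs
      simp only [Complex.real_smul]
      push_cast
      field_simp
      ring
  have hba : ∀ i, b i = a (i + 1) := by
    intro i
    have h1 := (hb i).symm.trans (ha (i + 1))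
    have h2 := congrArg (fun z => ‖z‖ ^ 2) h1
    simp only [norm_mul, mul_pow, hu] at h2
    rw [norm_sq_eq_re_add_im (1 + _), norm_sq_eq_re_add_im (1 - _)] at h2
    have hn : ‖(Real.tanh r : ℂ)‖ ≠ 0 := by
      rw [Complex.norm_real]; exact norm_ne_zero_iff.2 hR.ne'
    have h3 : b i ^ 2 = a (i + 1) ^ 2 := by
      have := mul_left_cancel₀ (mul_ne_zero (pow_ne_zero 2 hn) (by norm_num : (1 : ℝ) ^ 2 ≠ 0)) h2
      simp at this
      simpa using this
    rcases sq_eq_sq_iff_eq_or_eq_neg.1 h3 with h | h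
    · exact h
    have hne : (1 + (b i : ℂ) * Complex.I) ≠ 0 := by
      intro h0
      have := congrArg Complex.re h0
      simp at this
    have e : (1 + (b i : ℂ) * Complex.I) = 1 - a (i + 1) * Complex.I := by
      rw [h]; push_cast; ring
    rw [← e] at h1
    -- With the opposite sign both sides would touch the circle at the same point. Being common to
    -- adjacent sides, it is their vertex, so the tangent length is zero.
    have huu : u i = u (i + 1) := mul_left_cancel₀ hRc (mul_right_cancel₀ hne h1)
    have h4 := hadj i _ (hmid i) (huu ▸ hmid (i + 1))
    rw [hb, eq_comm, mul_eq_left₀ (mul_ne_zero hRc (fun h0 => by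
      have := hu i; rw [h0, norm_zero] at this; exact zero_ne_one this))] at h4
    have h5 := congrArg Complex.im h4
    simp at h5
    rw [h5] at h
    linarith
  simp only [hba] at hab hab0 hb
  have hsign := all_nonneg_or_all_nonpos a hab hab0 (by
    intro i hi
    by_contra! hneg
    have hv : klein c 1 (P.vertex (i + 1)) = Real.tanh r * u i := by rw [hb, hi]; simp
    have huu : u (i + 1) = u i := by
      have h1 := (ha (i + 1)).symm.trans hv
      rw [hi] at h1
      simpa [hRc, -Complex.ofReal_tanh] using h1
    set p := -a i with hp
    set q := a (i + 1 + 1) with hq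
    have hpq : 0 < p * q := by rw [hp]; linarith
    have hpq2 : 0 < (p + q) ^ 2 := by nlinarith [sq_nonneg p, sq_nonneg q]
    have hpq0 : p + q ≠ 0 := by rintro h; rw [h] at hpq2; norm_num at hpq2
    have hpqc : (p + q : ℂ) ≠ 0 := by exact_mod_cast hpq0
    have h1 : 0 < q * (p + q) := by nlinarith [sq_nonneg q]
    have h2 : 0 < p * (p + q) := by nlinarith [sq_nonneg p]
    have hai : a i = -p := by rw [hp]; ring
    -- Here the vertex is the point of tangency of both sides, and its neighbours lie at parameters
    -- `p` and `q` of the same sign on one tangent. The parameter `p * q / (p + q)` lies strictly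
    -- between `0` and both, so the sides would overlap beyond the vertex.
    have := hadj i (Real.tanh r * u i * (1 + ((p * q / (p + q) : ℝ) : ℂ) * Complex.I)) ?_ ?_
    · rw [hv, mul_eq_left₀ (mul_ne_zero hRc (fun h0 => by
        have := hu i; rw [h0, norm_zero] at this; exact zero_ne_one this))] at this
      have h5 := congrArg Complex.im this
      rw [Complex.add_im, Complex.im_ofReal_mul, Complex.I_im, Complex.one_im, mul_one, zero_add,
        div_eq_zero_iff, mul_eq_zero] at h5
      rcases h5 with (h | h) | h
      · rw [h] at hpq; simp at hpq
      · rw [h] at hpq; simp at hpq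
      · exact hpq0 h
    · rw [hv, ha, hai]
      refine ⟨q * (p + q) / (p + q) ^ 2, p * (p + q) / (p + q) ^ 2, by positivity, by positivity,
        by field_simp; ring, ?_⟩
      simp only [Complex.real_smul]
      push_cast
      field_simp
      ring
    · rw [hv, hb, huu]
      refine ⟨q * (p + q) / (p + q) ^ 2, p * (p + q) / (p + q) ^ 2, by positivity, by positivity,
        by field_simp; ring, ?_⟩
      simp only [Complex.real_smul]
      push_cast
      field_simp
      ring)
  have hne : ∃ i, a i ≠ 0 := by
    by_contra! h
    exact hab0 0 (by rw [h, h, add_zero])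
  obtain ⟨i0, hi0⟩ := hne
  rcases hsign with hs | hs
  · obtain ⟨C, hC, hC2⟩ := exists_tangentCycle_of_tan hR.ne' hs hu ha hb
    refine ⟨1, C, hσ, hC, i0, ?_⟩
    rw [hC2]
    exact Real.arctan_pos.2 (lt_of_le_of_ne (hs i0) hi0.symm)
  · obtain ⟨C, hC, hC2⟩ := exists_tangentCycle_of_tan (R := Real.tanh r) hR.ne'
      (a := fun i => -a i) (u := fun i => (starRingEnd ℂ) (u i))
      (v := fun i => klein c (-1) (P.vertex i)) (fun i => by simpa using hs i)
      (fun i => by simpa using hu i)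
      (fun i => by rw [klein_neg_one, ha]; simp [-Complex.ofReal_tanh])
      (fun i => by rw [klein_neg_one, hb]; simp [-Complex.ofReal_tanh])
    refine ⟨-1, C, by norm_num, hC, i0, ?_⟩
    rw [hC2]
    exact Real.arctan_pos.2 (by have := lt_of_le_of_ne (hs i0) hi0; linarith)

end Polygon

end

/-! ### The enclosed region and the area formula -/

section

variable {c : ℍ} {σ : ℝ}

theorem one_sub_mul_klein_im (hσ : σ ^ 2 = 1) (z : ℍ) :
    1 - σ * (klein c σ z).im = 2 * c.im ^ 2 / kleinDenom c z := by
  have h := kleinDenom_pos c z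
  have : σ * (klein c σ z).im =
      σ ^ 2 * (((z.re - c.re) ^ 2 + z.im ^ 2 - c.im ^ 2) / kleinDenom c z) := by
    simp only [klein]; ring
  rw [this, hσ]
  field_simp
  unfold kleinDenom
  ring

theorem sqrt_one_sub_norm_klein_sq (hσ : σ ^ 2 = 1) (z : ℍ) :
    √(1 - ‖klein c σ z‖ ^ 2) = (lorentz c z)⁻¹ := by
  have h1 := lorentz_sq_mul (c := c) hσ z
  have h2 := lorentz_pos c z
  rw [Real.sqrt_eq_iff_mul_self_eq_of_pos (inv_pos.2 h2)]
  field_simp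
  linarith

/-- The Klein map has a continuous inverse. -/
theorem exists_continuous_rightInverse_klein (c : ℍ) (hσ : σ ^ 2 = 1) :
    ∃ g : Metric.ball (0 : ℂ) 1 → ℍ, Continuous g ∧ ∀ k, klein c σ (g k) = k := by
  have hex : ∀ k : Metric.ball (0 : ℂ) 1, ∃ z, klein c σ z = k := fun k =>
    exists_klein_eq hσ (mem_ball_zero_iff.1 k.2)
  choose g hg using hex
  refine ⟨g, ?_, hg⟩
  have hpos : ∀ k : Metric.ball (0 : ℂ) 1, 1 - σ * (k : ℂ).im ≠ 0 := by
    intro k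
    rw [← hg k, one_sub_mul_klein_im hσ]
    have := kleinDenom_pos c (g k)
    have := c.im_pos
    positivity
  have hre : ∀ k : Metric.ball (0 : ℂ) 1,
      (g k).re = c.re + c.im * (k : ℂ).re / (1 - σ * (k : ℂ).im) := by
    intro k
    have h1 := kleinDenom_pos c (g k)
    have h2 := c.im_pos
    rw [← hg k, one_sub_mul_klein_im hσ, hg k, ← congrArg Complex.re (hg k)]
    simp only [klein]
    field_simp
    ring
  have him : ∀ k : Metric.ball (0 : ℂ) 1,
      (g k).im = c.im * √(1 - ‖(k : ℂ)‖ ^ 2) / (1 - σ * (k : ℂ).im) := by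
    intro k
    have h1 := kleinDenom_pos c (g k)
    have h2 := c.im_pos
    have h3 := (g k).im_pos
    rw [← hg k, one_sub_mul_klein_im hσ, sqrt_one_sub_norm_klein_sq hσ, lorentz]
    field_simp
  rw [UpperHalfPlane.isOpenEmbedding_coe.isEmbedding.continuous_iff]
  have e : ((↑) : ℍ → ℂ) ∘ g = fun k : Metric.ball (0 : ℂ) 1 =>
      ((c.re + c.im * (k : ℂ).re / (1 - σ * (k : ℂ).im) : ℝ) : ℂ) +
      ((c.im * √(1 - ‖(k : ℂ)‖ ^ 2) / (1 - σ * (k : ℂ).im) : ℝ) : ℂ) * Complex.I := by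
    funext k
    rw [← hre, ← him]
    exact ((g k).re_add_im).symm
  rw [e]
  have h1 : Continuous fun k : Metric.ball (0 : ℂ) 1 => (k : ℂ).re :=
    Complex.continuous_re.comp continuous_subtype_val
  have h2 : Continuous fun k : Metric.ball (0 : ℂ) 1 => (k : ℂ).im :=
    Complex.continuous_im.comp continuous_subtype_val
  have c1 : Continuous fun k : Metric.ball (0 : ℂ) 1 =>
      c.re + c.im * (k : ℂ).re / (1 - σ * (k : ℂ).im) :=
    continuous_const.add (Continuous.div (by fun_prop) (by fun_prop) hpos)
  have c2 : Continuous fun k : Metric.ball (0 : ℂ) 1 =>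
      c.im * √(1 - ‖(k : ℂ)‖ ^ 2) / (1 - σ * (k : ℂ).im) :=
    Continuous.div (by fun_prop) (by fun_prop) hpos
  fun_prop

theorem isBounded_of_norm_klein_le (hσ : σ ^ 2 = 1) {m : ℝ} (hm : m < 1) :
    Bornology.IsBounded {z : ℍ | ‖klein c σ z‖ ≤ m} := by
  refine (Metric.isBounded_closedBall (x := c) (r := (√(1 - m ^ 2))⁻¹)).subset fun z hz => ?_
  have hz' : ‖klein c σ z‖ ≤ m := hz
  have hm0 : 0 ≤ m := (norm_nonneg _).trans hz'
  rw [Metric.mem_closedBall]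
  have h1 : dist z c ≤ lorentz c z := by
    rw [← cosh_dist_center]
    exact (Real.self_le_sinh_iff.2 dist_nonneg).trans (Real.sinh_lt_cosh _).le
  refine h1.trans ?_
  rw [← inv_inv (lorentz c z), ← sqrt_one_sub_norm_klein_sq hσ]
  have : 0 < 1 - m ^ 2 := by nlinarith
  gcongr

/-- A set on which the Klein map comes close to the unit circle is unbounded. -/
theorem not_isBounded_of_exists_lt_norm_klein (hσ : σ ^ 2 = 1) {S : Set ℍ}
    (hS : ∀ m < 1, ∃ z ∈ S, m < ‖klein c σ z‖) : ¬ Bornology.IsBounded S := by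
  intro hb
  obtain ⟨B, hB⟩ := (Metric.isBounded_iff_subset_closedBall c).1 hb
  obtain ⟨z, hz, hlt⟩ := hS (√(1 - (Real.cosh B)⁻¹ ^ 2)) (by
    have hK := Real.cosh_pos B
    rw [Real.sqrt_lt' one_pos]
    have : 0 < (Real.cosh B)⁻¹ ^ 2 := by positivity
    linarith)
  have hd : dist z c ≤ B := hB hz
  have hl : lorentz c z ≤ Real.cosh B := by
    rw [← cosh_dist_center, Real.cosh_le_cosh, abs_of_nonneg dist_nonneg]
    exact hd.trans (le_abs_self B)
  have h1 := lorentz_sq_mul (c := c) hσ z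
  have h2 := lorentz_pos c z
  rw [Real.sqrt_lt' ((Real.sqrt_nonneg _).trans_lt hlt)] at hlt
  have h3 : (Real.cosh B)⁻¹ ^ 2 ≤ (lorentz c z)⁻¹ ^ 2 := by gcongr
  have h4 : (lorentz c z)⁻¹ ^ 2 = 1 - ‖klein c σ z‖ ^ 2 := by
    field_simp; linarith
  linarith

theorem TangentCycle.norm_vertex {n : ℕ} (C : TangentCycle n) {R : ℝ} (hR : 0 ≤ R) (i : ZMod n) :
    ‖C.vertex R i‖ = R / Real.cos (C.halfAngle i) := by
  have hc := C.cos_halfAngle_pos i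
  have e := one_add_tan_mul_I (x := -C.halfAngle i) (by rw [Real.cos_neg]; exact hc.ne')
  rw [Real.tan_neg, Real.cos_neg] at e
  have e2 : (1 - (Real.tan (C.halfAngle i) : ℂ) * Complex.I) =
      1 + ((-Real.tan (C.halfAngle i) : ℝ) : ℂ) * Complex.I := by push_cast; ring
  rw [TangentCycle.vertex, e2, e, norm_mul, norm_mul, norm_div, C.norm_point,
    Complex.norm_exp_ofReal_mul_I, Complex.norm_real, Complex.norm_real, Real.norm_of_nonneg hR,
    Real.norm_of_nonneg hc.le]
  ring

namespace Polygon

variable {n : ℕ} {P : Polygon n} {r : ℝ} {C : TangentCycle n}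

theorem lt_cos_halfAngle (hσ : σ ^ 2 = 1) {R : ℝ} (hR : 0 ≤ R)
    (hV : ∀ i, klein c σ (P.vertex i) = C.vertex R i) (i : ZMod n) :
    R < Real.cos (C.halfAngle i) := by
  have h := norm_klein_lt_one (c := c) hσ (P.vertex i)
  rwa [hV, C.norm_vertex hR, div_lt_one (C.cos_halfAngle_pos i)] at h

theorem sum_halfAngle [NeZero n] (hσ : σ ^ 2 = 1) {R : ℝ}
    (hV : ∀ i, klein c σ (P.vertex i) = C.vertex R i) (hpos : ∃ i, 0 < C.halfAngle i) :
    ∑ i, C.halfAngle i = Real.pi := by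
  refine C.sum_halfAngle_eq_pi P.three_le (R := R) hpos fun i j h1 h2 h3 => ?_
  rw [Set.disjoint_left]
  intro k hk1 hk2
  simp only [← hV] at hk1 hk2
  have hk : ‖k‖ < 1 := by
    have := (convex_ball (0 : ℂ) 1).segment_subset
      (by simpa using norm_klein_lt_one (c := c) hσ (P.vertex i))
      (by simpa using norm_klein_lt_one (c := c) hσ (P.vertex (i + 1))) hk1
    simpa using this
  obtain ⟨z, rfl⟩ := exists_klein_eq (c := c) hσ hk
  rw [← mem_segment_iff hσ] at hk1 hk2
  exact Set.disjoint_left.1 (P.nonadjacent_sides i j h1 h2 h3) hk1 hk2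

variable [NeZero n]

theorem mem_boundary_iff (hσ : σ ^ 2 = 1) {R : ℝ} (hR : 0 < R)
    (hV : ∀ i, klein c σ (P.vertex i) = C.vertex R i) (hC : ∑ i, C.halfAngle i = Real.pi)
    (x : ℍ) : x ∈ P.boundary ↔ C.support (klein c σ x) = R := by
  rw [← TangentCycle.exists_mem_side_iff hC hR]
  simp only [boundary, side, Set.mem_iUnion, mem_segment_iff (c := c) hσ, hV]

/-- The region of a tangential polygon is cut out by the tangents. -/
theorem region_eq (hσ : σ ^ 2 = 1) {R : ℝ} (hR : 0 < R)
    (hV : ∀ i, klein c σ (P.vertex i) = C.vertex R i) (hC : ∑ i, C.halfAngle i = Real.pi) :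
    P.region = {x | C.support (klein c σ x) ≤ R} := by
  have hb := mem_boundary_iff (P := P) hσ hR hV hC
  obtain ⟨m, hm1, hm⟩ := TangentCycle.exists_norm_le hC (lt_cos_halfAngle hσ hR.le hV)
  have hcont : Continuous fun x : ℍ => C.support (klein c σ x) :=
    C.continuous_support.comp continuous_klein
  ext x
  simp only [region, Set.mem_union, Set.mem_ofPred_eq, hb]
  rcases lt_trichotomy (C.support (klein c σ x)) R with h | h | h
  -- Inside: the support function is continuous and misses the value `R` on the connected component,
  -- so it stays below `R` there and the component is bounded.
  · refine iff_of_true (Or.inr ⟨h.ne, ?_⟩) h.le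
    refine (isBounded_of_norm_klein_le (c := c) hσ hm1).subset fun y hy => hm _ ?_
    by_contra! hlt
    have hx : x ∈ connectedComponentIn P.boundaryᶜ x :=
      mem_connectedComponentIn fun hx => h.ne ((hb x).1 hx)
    have hpre := (isPreconnected_connectedComponentIn (F := P.boundaryᶜ) (x := x)).image _
      hcont.continuousOn
    obtain ⟨w, hw, hwR⟩ := hpre.ordConnected.out (Set.mem_image_of_mem _ hx)
      (Set.mem_image_of_mem _ hy) ⟨h.le, hlt.le⟩
    exact connectedComponentIn_subset _ _ hw ((hb w).2 hwR)
  · exact iff_of_true (Or.inl h) h.le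
  · refine iff_of_false ?_ h.not_ge
    rintro (h1 | ⟨-, h1⟩)
    · exact h.ne' h1
    -- Outside: moving radially outwards from `x` increases the support function, so the path avoids
    -- the boundary and comes arbitrarily close to the unit circle.
    refine not_isBounded_of_exists_lt_norm_klein (c := c) hσ (fun m hm => ?_) h1
    obtain ⟨g, hg, hkg⟩ := exists_continuous_rightInverse_klein c hσ
    set k := klein c σ x with hk
    have hk0 : k ≠ 0 := by
      intro h0; rw [h0, C.support_zero] at h; exact absurd h hR.not_gt
    have hkn : 0 < ‖k‖ := norm_pos_iff.2 hk0
    have hk1 : ‖k‖ < 1 := norm_klein_lt_one hσ x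
    obtain ⟨q, hq1, hq2⟩ := exists_between (max_lt hm hk1)
    have hqk : ‖k‖ < q := (le_max_right _ _).trans_lt hq1
    have hs1 : 1 ≤ q / ‖k‖ := (one_le_div hkn).2 hqk.le
    have hball : ∀ t : Set.Icc 1 (q / ‖k‖), ((t : ℝ) : ℂ) * k ∈ Metric.ball (0 : ℂ) 1 := by
      intro t
      have h2 := t.2.2
      have h3 : 0 ≤ (t : ℝ) := zero_le_one.trans t.2.1
      rw [le_div_iff₀ hkn] at h2
      rw [mem_ball_zero_iff, norm_mul, Complex.norm_real, Real.norm_of_nonneg h3]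
      exact h2.trans_lt hq2
    set p : Set.Icc 1 (q / ‖k‖) → ℍ := fun t => g ⟨((t : ℝ) : ℂ) * k, hball t⟩ with hp
    have hpc : Continuous p := hg.comp (by fun_prop)
    have hkp : ∀ t, klein c σ (p t) = ((t : ℝ) : ℂ) * k := fun t => hkg _
    have hpre : IsPreconnected (Set.range p) := by
      have : PreconnectedSpace (Set.Icc 1 (q / ‖k‖)) :=
        Subtype.preconnectedSpace isPreconnected_Icc
      exact isPreconnected_range hpc
    have hx : x ∈ Set.range p := by
      refine ⟨⟨1, le_rfl, hs1⟩, klein_injective (c := c) hσ ?_⟩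
      rw [hkp, ← hk]; simp
    have hsub : Set.range p ⊆ P.boundaryᶜ := by
      rintro _ ⟨t, rfl⟩ hmem
      rw [hb, hkp, C.support_smul (zero_le_one.trans t.2.1)] at hmem
      have := t.2.1
      nlinarith
    have hsub2 := hpre.subset_connectedComponentIn hx hsub
    refine ⟨p ⟨q / ‖k‖, hs1, le_rfl⟩, hsub2 ⟨_, rfl⟩, ?_⟩
    rw [hkp, norm_mul, Complex.norm_real, Real.norm_of_nonneg (zero_le_one.trans hs1),
      div_mul_cancel₀ _ hkn.ne']
    exact (le_max_left _ _).trans_lt hq1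

theorem cosh_mul_sin_halfAngle_lt {n : ℕ} {C : TangentCycle n} {r : ℝ}
    (hrC : ∀ i, Real.tanh r < Real.cos (C.halfAngle i)) (hr : 0 < r) (i : ZMod n) :
    Real.cosh r * Real.sin (C.halfAngle i) < 1 := by
  have h1 := cosh_sq_mul_one_sub_tanh_sq r
  have h2 := Real.cosh_pos r
  have h3 := tanh_pos_of_pos hr
  have h4 := hrC i
  have h5 := Real.sin_sq_add_cos_sq (C.halfAngle i)
  have h6 : Real.tanh r ^ 2 < Real.cos (C.halfAngle i) ^ 2 := by gcongr
  have h7 : (Real.cosh r * Real.sin (C.halfAngle i)) ^ 2 < 1 := by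
    rw [mul_pow]
    have : 0 < Real.cosh r ^ 2 := by positivity
    nlinarith
  exact (abs_lt.1 ((sq_lt_one_iff_abs_lt_one _).1 h7)).2

theorem area_eq (hσ : σ ^ 2 = 1) (hr : 0 < r)
    (hV : ∀ i, klein c σ (P.vertex i) = C.vertex (Real.tanh r) i)
    (hC : ∑ i, C.halfAngle i = Real.pi) :
    P.area = 2 * ∑ i, Real.arcsin (Real.cosh r * Real.sin (C.halfAngle i)) - 2 * Real.pi := by
  have hR := tanh_pos_of_pos hr
  have hrC := lt_cos_halfAngle hσ hR.le hV
  obtain ⟨m, hm1, hm⟩ := TangentCycle.exists_norm_le hC hrC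
  set A : Set (ℝ × ℝ) :=
    {v | C.support (Complex.measurableEquivRealProd.symm v) ≤ Real.tanh r} with hA
  have hmeas : MeasurableSet A :=
    measurableSet_le (C.continuous_support.measurable.comp
      Complex.measurableEquivRealProd.symm.measurable) measurable_const
  have e : P.region = klein c σ ⁻¹' (Complex.measurableEquivRealProd ⁻¹' A) := by
    rw [region_eq hσ hR hV hC]
    ext x
    simp [hA]
  have hA1 : ∀ v ∈ A, v.1 ^ 2 + v.2 ^ 2 < 1 := by
    intro v hv
    have h1 := hm _ hv
    have h2 := norm_sq_eq_re_add_im (Complex.measurableEquivRealProd.symm v)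
    have h3 := norm_nonneg (Complex.measurableEquivRealProd.symm v)
    have h4 : ‖Complex.measurableEquivRealProd.symm v‖ ^ 2 = v.1 ^ 2 + v.2 ^ 2 := h2
    rw [← h4]
    nlinarith
  rw [area, e, Measure.real, volume_preimage_klein hσ hmeas hA1,
    TangentCycle.lintegral_kleinDensity_support_le hC hr hrC, ENNReal.toReal_ofReal]
  -- `ENNReal.ofReal` truncates at zero, so the formula has to be seen to be nonnegative: each
  -- summand is at least `arcsin (sin (α i)) = α i`.
  rw [← hC, ← mul_sub, ← Finset.sum_sub_distrib]
  refine mul_nonneg zero_le_two (Finset.sum_nonneg fun i _ => sub_nonneg.2 ?_)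
  have h0 := C.halfAngle_nonneg i
  have h1 := C.halfAngle_lt i
  have hs : 0 ≤ Real.sin (C.halfAngle i) :=
    Real.sin_nonneg_of_nonneg_of_le_pi h0 (by linarith [Real.pi_pos])
  calc C.halfAngle i = Real.arcsin (Real.sin (C.halfAngle i)) :=
        (Real.arcsin_sin (by linarith [Real.pi_pos]) h1.le).symm
    _ ≤ _ := Real.arcsin_le_arcsin (le_mul_of_one_le_left hs (Real.one_le_cosh r))

end Polygon

end

/-! ### Strict convexity -/

section

/-- The square of the derivative is `K ^ 2 * (1 - s) / (1 - K ^ 2 * s)` with `s = sin x ^ 2`, which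
increases strictly in `s` because `K > 1`. The interval ends where `K * sin x` reaches `1`. -/
theorem strictConvexOn_arcsin_mul_sin {K : ℝ} (hK : 1 < K) :
    StrictConvexOn ℝ (Set.Ico 0 (Real.arcsin K⁻¹)) fun x => Real.arcsin (K * Real.sin x) := by
  have hK0 : 0 < K := by linarith
  have hKi : K⁻¹ < 1 := inv_lt_one_of_one_lt₀ hK
  have hA : Real.arcsin K⁻¹ < Real.pi / 2 := by
    have := Real.arcsin_lt_pi_div_two.2 hKi
    exact this
  have hlt : ∀ x, 0 ≤ x → x < Real.arcsin K⁻¹ → K * Real.sin x < 1 := by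
    intro x h0 h1
    have : Real.sin x < K⁻¹ := by
      rw [← Real.sin_arcsin (x := K⁻¹) (by linarith [inv_pos.2 hK0]) hKi.le]
      exact Real.strictMonoOn_sin ⟨by linarith [Real.pi_pos], by linarith⟩
        ⟨by linarith [Real.pi_pos], hA.le⟩ h1
    calc K * Real.sin x < K * K⁻¹ := by gcongr
      _ = 1 := mul_inv_cancel₀ hK0.ne'
  have hnn : ∀ x, 0 ≤ x → x < Real.arcsin K⁻¹ → 0 ≤ Real.sin x := fun x h0 h1 =>
    Real.sin_nonneg_of_nonneg_of_le_pi h0 (by linarith [Real.pi_pos])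
  have hderiv : ∀ x, 0 ≤ x → x < Real.arcsin K⁻¹ →
      HasDerivAt (fun x => Real.arcsin (K * Real.sin x))
        (1 / √(1 - (K * Real.sin x) ^ 2) * (K * Real.cos x)) x := by
    intro x h0 h1
    have h2 := hlt x h0 h1
    have h3 : 0 ≤ K * Real.sin x := mul_nonneg hK0.le (hnn x h0 h1)
    exact (Real.hasDerivAt_arcsin (by linarith) h2.ne).comp x
      ((Real.hasDerivAt_sin x).const_mul K)
  refine StrictMonoOn.strictConvexOn_of_deriv (convex_Ico _ _) (by fun_prop) ?_
  rw [interior_Ico]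
  intro x hx y hy hxy
  rw [(hderiv x hx.1.le hx.2).deriv, (hderiv y hy.1.le hy.2).deriv]
  have hsx := hnn x hx.1.le hx.2
  have hsy := hnn y hy.1.le hy.2
  have hs : Real.sin x < Real.sin y :=
    Real.strictMonoOn_sin ⟨by linarith [Real.pi_pos, hx.1], by linarith [hx.2]⟩
      ⟨by linarith [Real.pi_pos, hy.1], by linarith [hy.2]⟩ hxy
  have hpx : 0 < 1 - (K * Real.sin x) ^ 2 := by
    have := hlt x hx.1.le hx.2
    have := mul_nonneg hK0.le hsx
    nlinarith
  have hpy : 0 < 1 - (K * Real.sin y) ^ 2 := by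
    have := hlt y hy.1.le hy.2
    have := mul_nonneg hK0.le hsy
    nlinarith
  have hcx : 0 < Real.cos x := Real.cos_pos_of_mem_Ioo ⟨by linarith [Real.pi_pos, hx.1],
    by linarith [hx.2]⟩
  have hcy : 0 < Real.cos y := Real.cos_pos_of_mem_Ioo ⟨by linarith [Real.pi_pos, hy.1],
    by linarith [hy.2]⟩
  have hqx := Real.sqrt_pos.2 hpx
  have hqy := Real.sqrt_pos.2 hpy
  refine lt_of_pow_lt_pow_left₀ 2 (by positivity) ?_
  have hsq : ∀ q z : ℝ, 0 < q → (1 / √q * z) ^ 2 = z ^ 2 / q := fun q z hq => by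
    rw [one_div_mul_eq_div, div_pow, Real.sq_sqrt hq.le]
  rw [hsq _ _ hpx, hsq _ _ hpy, div_lt_div_iff₀ hpx hpy]
  simp only [mul_pow, Real.cos_sq']
  have h1 : Real.sin x ^ 2 < Real.sin y ^ 2 := by gcongr
  -- After cross-multiplication the two sides differ by this constant times `sin y ^ 2 - sin x ^ 2`.
  have h2 : 0 < K ^ 2 * (K ^ 2 - 1) := by
    have : 1 < K ^ 2 := by nlinarith
    exact mul_pos (by positivity) (by linarith)
  nlinarith [mul_lt_mul_of_pos_left h1 h2]

end

/-! ### Interior angles and regularity in terms of the half angles -/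

section

variable {c : ℍ} {σ : ℝ}

theorem kleinAngle_mul {w : ℂ} (hw : ‖w‖ = 1) (σ l : ℝ) (k d e : ℂ) :
    kleinAngle σ l (w * k) (w * d) (w * e) = kleinAngle σ l k d e := by
  have h := norm_sq_eq_re_add_im w
  rw [hw] at h
  have hi : ∀ a b : ℂ, inner ℝ (w * a) (w * b) = inner ℝ a b := fun a b => by
    simp only [inner_eq_re_add_im, Complex.mul_re, Complex.mul_im]
    linear_combination -(a.re * b.re + a.im * b.im) * h
  have hc : cross (w * d) (w * e) = cross d e := by
    simp only [cross, Complex.mul_re, Complex.mul_im]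
    linear_combination -(d.re * e.im - d.im * e.re) * h
  simp only [kleinAngle, hi, hc]

theorem kleinAngle_smul (σ l s t : ℝ) (k d e : ℂ) :
    kleinAngle σ l k (s * d) (t * e) = (s * t : ℝ) * kleinAngle σ l k d e := by
  apply Complex.ext
  · rw [Complex.re_ofReal_mul]
    simp only [kleinAngle, ← Complex.real_smul, real_inner_smul_left, real_inner_smul_right]
    ring
  · rw [Complex.im_ofReal_mul]
    simp only [kleinAngle, cross, Complex.re_ofReal_mul, Complex.im_ofReal_mul]
    ring

/-- A complex number whose argument is the angle between two tangents of the circle of radius `R`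
whose points of tangency are at the angle `2 * α`, where `l` is the Lorentz factor of their
common point. -/
def tangentAngle (σ R l α : ℝ) : ℂ :=
  ⟨l ^ 2 * (R * Real.tan α) ^ 2 - Real.cos (2 * α), σ * l * Real.sin (2 * α)⟩

namespace Polygon

variable {n : ℕ} {P : Polygon n} {r : ℝ} {C : TangentCycle n}

theorem lorentz_sq_vertex (hσ : σ ^ 2 = 1) {R : ℝ} (hR : 0 ≤ R)
    (hV : ∀ i, klein c σ (P.vertex i) = C.vertex R i) (i : ZMod n) :
    lorentz c (P.vertex i) ^ 2 * (1 - (R / Real.cos (C.halfAngle i)) ^ 2) = 1 := by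
  rw [← C.norm_vertex hR, ← hV]
  exact lorentz_sq_mul hσ _

theorem tan_add_tan_pos {R : ℝ} (hV : ∀ i, klein c σ (P.vertex i) = C.vertex R i)
    (hσ : σ ^ 2 = 1) (i : ZMod n) :
    0 < Real.tan (C.halfAngle i) + Real.tan (C.halfAngle (i + 1)) := by
  have h : ∀ i, 0 ≤ Real.tan (C.halfAngle i) := fun i =>
    Real.tan_nonneg_of_nonneg_of_le_pi_div_two (C.halfAngle_nonneg i) (C.halfAngle_lt i).le
  refine lt_of_le_of_ne (add_nonneg (h i) (h (i + 1))) fun h0 => ?_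
  have h1 : Real.tan (C.halfAngle i) = 0 := by linarith [h i, h (i + 1)]
  have h2 : Real.tan (C.halfAngle (i + 1)) = 0 := by linarith [h i, h (i + 1)]
  refine vertex_ne_succ (P := P) i (klein_injective (c := c) hσ ?_)
  rw [hV, hV, C.vertex_succ, TangentCycle.vertex, h1, h2]
  simp

/-- A rotation takes the point of tangency after the vertex to `1`. Both sides at the vertex are
positive multiples of unit tangent vectors, and such factors do not change the argument. -/
theorem vertexAngle_eq (hσ : σ ^ 2 = 1) {R : ℝ} (hR : 0 < R)
    (hV : ∀ i, klein c σ (P.vertex i) = C.vertex R i) (i : ZMod n) :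
    P.vertexAngle i =
      ((tangentAngle σ R (lorentz c (P.vertex i)) (C.halfAngle i)).arg : Real.Angle) := by
  obtain ⟨j, rfl⟩ : ∃ j, i = j + 1 := ⟨i - 1, by ring⟩
  have hsum1 := tan_add_tan_pos hV hσ j
  have hsum2 := tan_add_tan_pos hV hσ (j + 1)
  have hc := C.cos_halfAngle_pos (j + 1)
  have hu := C.norm_point (j + 1)
  set α := C.halfAngle (j + 1) with hα
  have hpt : C.point j = C.point (j + 1) * (Real.cos (2 * α) - Real.sin (2 * α) * Complex.I) := by
    rw [C.point_succ, ← hα, mul_assoc]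
    have : Complex.exp ((2 * α : ℝ) * Complex.I) *
        (Real.cos (2 * α) - Real.sin (2 * α) * Complex.I) = 1 := by
      rw [Complex.exp_mul_I, ← Complex.ofReal_cos, ← Complex.ofReal_sin]
      have h := Real.sin_sq_add_cos_sq (2 * α)
      have h2 : ((Real.sin (2 * α) ^ 2 + Real.cos (2 * α) ^ 2 : ℝ) : ℂ) = 1 := by rw [h]; simp
      rw [Complex.ofReal_add, Complex.ofReal_pow, Complex.ofReal_pow] at h2
      linear_combination h2 - (Real.sin (2 * α) : ℂ) ^ 2 * Complex.I_sq
    rw [this, mul_one]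
  rw [vertexAngle, orientedAngle_eq_arg (c := c) hσ (vertex_ne_succ (P := P) (j + 1)).symm,
    add_sub_cancel_right, hV, hV, hV]
  have e1 : C.vertex R (j + 1 + 1) - C.vertex R (j + 1) =
      ((R * (Real.tan α + Real.tan (C.halfAngle (j + 1 + 1))) : ℝ) : ℂ) *
        (C.point (j + 1) * Complex.I) := by
    rw [C.vertex_succ, TangentCycle.vertex, ← hα, Complex.ofReal_mul, Complex.ofReal_add]
    ring
  have e2 : C.vertex R j - C.vertex R (j + 1) =
      ((R * (Real.tan (C.halfAngle j) + Real.tan α) : ℝ) : ℂ) *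
        (C.point (j + 1) * (-(Real.cos (2 * α) - Real.sin (2 * α) * Complex.I) * Complex.I)) := by
    rw [C.vertex_succ, TangentCycle.vertex, ← hα, hpt, Complex.ofReal_mul, Complex.ofReal_add]
    ring
  have e3 : C.vertex R (j + 1) = C.point (j + 1) * (R * (1 - Real.tan α * Complex.I)) := by
    rw [TangentCycle.vertex]; ring
  rw [e1, e2, e3, kleinAngle_smul, kleinAngle_mul hu, Complex.arg_real_mul _ (by positivity)]
  congr 2
  have ht : Real.tan α * Real.cos α = Real.sin α := Real.tan_mul_cos hc.ne'
  have key : -(R * Real.sin (2 * α)) + R * Real.tan α * Real.cos (2 * α) = -(R * Real.tan α) := by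
    rw [Real.sin_two_mul, Real.cos_two_mul, ← ht]; ring
  apply Complex.ext
  · simp only [kleinAngle, tangentAngle, inner_eq_re_add_im]
    simp [-Complex.ofReal_cos, -Complex.ofReal_sin, -Complex.ofReal_tan]
    linear_combination (-(lorentz c (P.vertex (j + 1))) ^ 2 * (R * Real.tan α)) * key
  · simp only [kleinAngle, tangentAngle, cross]
    simp [-Complex.ofReal_cos, -Complex.ofReal_sin, -Complex.ofReal_tan]

/-- The relation `cos (β / 2) = cosh r * sin α` in the right triangle formed by centre, vertex and
point of tangency. In double-angle form it does not depend on the orientation `σ`. -/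
theorem cos_vertexAngle (hσ : σ ^ 2 = 1) (hr : 0 < r)
    (hV : ∀ i, klein c σ (P.vertex i) = C.vertex (Real.tanh r) i) (i : ZMod n) :
    (P.vertexAngle i).cos = 2 * Real.cosh r ^ 2 * Real.sin (C.halfAngle i) ^ 2 - 1 := by
  have hR := tanh_pos_of_pos hr
  have hl := lorentz_sq_vertex (P := P) hσ hR.le hV i
  have hlt := lt_cos_halfAngle hσ hR.le hV i
  have hK := cosh_sq_mul_one_sub_tanh_sq r
  have hc := C.cos_halfAngle_pos i
  rw [vertexAngle_eq hσ hR hV, Real.Angle.cos_coe]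
  set l := lorentz c (P.vertex i)
  set α := C.halfAngle i
  set R := Real.tanh r
  have ht : Real.tan α = Real.sin α / Real.cos α := Real.tan_eq_sin_div_cos α
  have hs := Real.sin_sq_add_cos_sq α
  have hm : 0 < Real.cos α ^ 2 - R ^ 2 := by nlinarith
  have hl2 : l ^ 2 = Real.cos α ^ 2 / (Real.cos α ^ 2 - R ^ 2) := by
    rw [eq_div_iff hm.ne']
    field_simp at hl
    linear_combination hl
  have hnorm : ‖tangentAngle σ R l α‖ = 1 + l ^ 2 * (R * Real.tan α) ^ 2 := by
    refine (pow_left_inj₀ (norm_nonneg _) (by positivity) two_ne_zero).1 ?_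
    rw [norm_sq_eq_re_add_im]
    simp only [tangentAngle]
    simp only [mul_pow, hσ, one_mul, hl2]
    rw [ht, Real.cos_two_mul, Real.sin_two_mul]
    have h2 : Real.sin α ^ 2 = 1 - Real.cos α ^ 2 := by linarith
    field_simp
    simp only [h2]
    ring
  have hpos : 0 < 1 + l ^ 2 * (R * Real.tan α) ^ 2 := by positivity
  have hK2 : Real.cosh r ^ 2 = 1 / (1 - R ^ 2) := by
    have h1 : 1 - R ^ 2 ≠ 0 := by
      intro h0; rw [h0, mul_zero] at hK; exact zero_ne_one hK
    rw [eq_div_iff h1, hK]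
  have h1 : 0 < 1 - R ^ 2 := by nlinarith [Real.sin_sq_add_cos_sq α, sq_nonneg (Real.sin α)]
  rw [Complex.cos_arg (by rw [← norm_pos_iff, hnorm]; exact hpos), hnorm, hK2]
  simp only [tangentAngle]
  have hden : 1 + l ^ 2 * (R * Real.tan α) ^ 2 =
      Real.cos α ^ 2 * (1 - R ^ 2) / (Real.cos α ^ 2 - R ^ 2) := by
    have h2 : Real.sin α ^ 2 = 1 - Real.cos α ^ 2 := by linarith
    rw [hl2, ht]
    field_simp
    simp only [h2]
    ring
  rw [hden, hl2, ht, Real.cos_two_mul]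
  have h2 : Real.sin α ^ 2 = 1 - Real.cos α ^ 2 := by linarith
  have hm' := hm.ne'
  have h1' := h1.ne'
  have hc' := hc.ne'
  rw [mul_pow, div_pow, h2]
  field_simp
  ring

/-- A tangential polygon is regular if and only if its points of tangency are equidistant. -/
theorem isRegular_iff (hσ : σ ^ 2 = 1) (hr : 0 < r)
    (hV : ∀ i, klein c σ (P.vertex i) = C.vertex (Real.tanh r) i) :
    P.IsRegular ↔ ∀ i j, C.halfAngle i = C.halfAngle j := by
  have hR := tanh_pos_of_pos hr
  constructor
  -- Equal angles alone suffice here: `sin ^ 2` of the half angle is determined by the cosine of the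
  -- vertex angle.
  · rintro ⟨-, h⟩ i j
    have h1 := congrArg Real.Angle.cos (h i j)
    rw [cos_vertexAngle hσ hr hV, cos_vertexAngle hσ hr hV] at h1
    have hK := Real.cosh_pos r
    have h2 : Real.sin (C.halfAngle i) ^ 2 = Real.sin (C.halfAngle j) ^ 2 := by
      have : 2 * Real.cosh r ^ 2 ≠ 0 := by positivity
      exact mul_left_cancel₀ this (by linarith)
    have hsin : ∀ i, 0 ≤ Real.sin (C.halfAngle i) := fun i =>
      Real.sin_nonneg_of_nonneg_of_le_pi (C.halfAngle_nonneg i)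
        (by linarith [C.halfAngle_lt i, Real.pi_pos])
    have h3 := (pow_left_inj₀ (hsin i) (hsin j) two_ne_zero).1 h2
    have hmem : ∀ i, C.halfAngle i ∈ Set.Icc (-(Real.pi / 2)) (Real.pi / 2) := fun i =>
      ⟨by linarith [C.halfAngle_nonneg i, Real.pi_pos], (C.halfAngle_lt i).le⟩
    exact Real.injOn_sin (hmem i) (hmem j) h3
  · intro h
    -- Equal half angles put all vertices at the same distance from the centre; side lengths and
    -- angles depend only on this and the half angles.
    have hl : ∀ i j, lorentz c (P.vertex i) = lorentz c (P.vertex j) := by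
      intro i j
      have h1 := lorentz_sq_vertex (P := P) hσ hR.le hV i
      have h2 := lorentz_sq_vertex (P := P) hσ hR.le hV j
      rw [← h i j] at h2
      have h3 : (1 - (Real.tanh r / Real.cos (C.halfAngle i)) ^ 2) ≠ 0 := by
        intro h0; rw [h0, mul_zero] at h1; exact zero_ne_one h1
      exact (pow_left_inj₀ (lorentz_pos _ _).le (lorentz_pos _ _).le two_ne_zero).1
        (mul_right_cancel₀ h3 (h1.trans h2.symm))
    refine ⟨fun i j => ?_, fun i j => ?_⟩
    · refine Real.cosh_injOn (Set.mem_Ici.2 dist_nonneg) (Set.mem_Ici.2 dist_nonneg) ?_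
      have hin : ∀ i, inner ℝ (C.vertex (Real.tanh r) i) (C.vertex (Real.tanh r) (i + 1)) =
          Real.tanh r ^ 2 * (1 - Real.tan (C.halfAngle i) * Real.tan (C.halfAngle (i + 1))) := by
        intro i
        have hu := norm_sq_eq_re_add_im (C.point i)
        rw [C.norm_point] at hu
        rw [C.vertex_succ, TangentCycle.vertex, inner_eq_re_add_im]
        simp [-Complex.ofReal_tanh, -Complex.ofReal_tan]
        linear_combination (-Real.tanh r ^ 2 *
          (1 - Real.tan (C.halfAngle i) * Real.tan (C.halfAngle (i + 1)))) * hu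
      change Real.cosh (dist _ _) = Real.cosh (dist _ _)
      rw [cosh_dist_eq (c := c) hσ, cosh_dist_eq (c := c) hσ, hV, hV, hV, hV, hin, hin, hl i j,
        hl (i + 1) (j + 1), h i j, h (i + 1) (j + 1)]
    · rw [vertexAngle_eq hσ hR hV, vertexAngle_eq hσ hR hV, hl i j, h i j]

end Polygon

end

end HyperbolicPlane

end

/-! ### The theorem, by Jensen's inequality for the half angles -/

theorem theorem3 (n : ℕ) (P : HyperbolicPlane.Polygon n) (c : ℍ) (r : ℝ)
    (hP : P.IsIncircle c r) :
    Real.sin (Real.pi / n) * Real.cosh r < 1 ∧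
    ((n : ℝ) - 2) * Real.pi - 2 * n * Real.arccos (Real.sin (Real.pi / n) * Real.cosh r)
      ≤ P.area ∧
    (P.area =
        ((n : ℝ) - 2) * Real.pi - 2 * n * Real.arccos (Real.sin (Real.pi / n) * Real.cosh r)
      ↔ P.IsRegular) := by
  open HyperbolicPlane in
  have : NeZero n := ⟨by have := P.three_le; omega⟩
  obtain ⟨σ, C, hσ, hV, hpos⟩ := hP.exists_cycle
  have hr := hP.1
  have hC := Polygon.sum_halfAngle hσ hV hpos
  have hrC := Polygon.lt_cos_halfAngle hσ (tanh_pos_of_pos hr).le hV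
  have hK1 : 1 < Real.cosh r := Real.one_lt_cosh.2 hr.ne'
  have hK0 : 0 < Real.cosh r := by linarith
  have hn0 : (0 : ℝ) < n := by exact_mod_cast Nat.pos_of_neZero n
  have hf := strictConvexOn_arcsin_mul_sin hK1
  have hKi : (Real.cosh r)⁻¹ ≤ 1 := inv_le_one_of_one_le₀ hK1.le
  have hKi0 : 0 < (Real.cosh r)⁻¹ := inv_pos.2 hK0
  have hmem : ∀ i ∈ Finset.univ, C.halfAngle i ∈ Set.Ico 0 (Real.arcsin (Real.cosh r)⁻¹) := by
    intro i _
    refine ⟨C.halfAngle_nonneg i, ?_⟩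
    rw [Real.lt_arcsin_iff_sin_lt' ⟨by linarith [C.halfAngle_nonneg i, Real.pi_pos],
      C.halfAngle_lt i⟩, ← one_div, lt_div_iff₀' hK0]
    exact Polygon.cosh_mul_sin_halfAngle_lt hrC hr i
  have hw0 : ∀ i ∈ (Finset.univ : Finset (ZMod n)), (0 : ℝ) < 1 / n := fun _ _ => by positivity
  have hw1 : ∑ _i : ZMod n, (1 : ℝ) / n = 1 := by
    rw [Finset.sum_const, Finset.card_univ, ZMod.card, nsmul_eq_mul]
    field_simp
  have hmean : ∑ i, (1 / n : ℝ) • C.halfAngle i = Real.pi / n := by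
    rw [← Finset.smul_sum, hC, smul_eq_mul]; ring
  -- The interval is convex, so it contains the mean of the half angles. This is already the first
  -- claim, `sin (π / n) * cosh r < 1`.
  have hmean_mem : Real.pi / n ∈ Set.Ico 0 (Real.arcsin (Real.cosh r)⁻¹) := by
    rw [← hmean]
    exact hf.1.sum_mem (fun i hi => (hw0 i hi).le) hw1 hmem
  have hlt : Real.sin (Real.pi / n) * Real.cosh r < 1 := by
    have h1 := hmean_mem.2
    rw [Real.lt_arcsin_iff_sin_lt' ⟨by linarith [hmean_mem.1, Real.pi_pos], h1.trans_le
      (Real.arcsin_le_pi_div_two _)⟩] at h1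
    calc _ < (Real.cosh r)⁻¹ * Real.cosh r := by gcongr
      _ = 1 := inv_mul_cancel₀ hK0.ne'
  have hbound : ((n : ℝ) - 2) * Real.pi -
      2 * n * Real.arccos (Real.sin (Real.pi / n) * Real.cosh r) =
      2 * n * Real.arcsin (Real.cosh r * Real.sin (Real.pi / n)) - 2 * Real.pi := by
    rw [Real.arccos, mul_comm (Real.cosh r)]; ring
  have hsum : ∑ i, (1 / n : ℝ) • Real.arcsin (Real.cosh r * Real.sin (C.halfAngle i)) =
      (∑ i, Real.arcsin (Real.cosh r * Real.sin (C.halfAngle i))) / n := by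
    rw [← Finset.smul_sum, smul_eq_mul]; ring
  have hle := hf.convexOn.map_sum_le (fun i hi => (hw0 i hi).le) hw1 hmem
  -- The equality case of Jensen: all weights are positive, so equality means that every half angle
  -- equals the mean.
  have heq := hf.map_sum_eq_iff hw0 hw1 hmem
  rw [hmean, hsum] at hle heq
  rw [hbound, Polygon.area_eq hσ hr hV hC, Polygon.isRegular_iff hσ hr hV]
  refine ⟨hlt, ?_, ?_⟩
  · rw [le_div_iff₀ hn0] at hle
    linarith
  · rw [eq_div_iff hn0.ne'] at heq
    constructor
    · intro h i j
      have := heq.1 (by linarith)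
      rw [this i (Finset.mem_univ i), this j (Finset.mem_univ j)]
    · intro h
      have := heq.2 fun j _ => by
        rw [← hmean]
        simp only [h _ j, ← Finset.sum_smul, hw1, one_smul]
      linarith
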